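/- A kissing configuration on a sphere of radius $r$ centered at the origin is a set of points of that sphere any two of which are separated by an angle of at least $\pi/3$; the kissing number in dimension $n$ is the largest size of such a set on the unit sphere of $\mathbb{R}^n$. (1) The kissing numbers in dimensions $25,26,27,28,29,30,31$ are at least $$197040,\ 198480,\ 199912,\ 204188,\ 207930,\ 219008,\ 230872,$$ respectively. (2) Let $\mathcal{C}$ be the set of minimal vectors (squared length $4$) of the Leech lattice $\Lambda_{24}\subset\mathbb{R}^{24}$, and call $S\subseteq\mathcal{C}$ admissible if $\langle x,y\rangle\le 1$ for all distinct $x,y\in S$. There is an admissible antipodal set ($S=-S$) with $480$ elements, and there is one with $288$ elements. (3) Let $S$ be any admissible set. Then there are pairwise disjoint sets $S_1=S,\ S_2,S_3,\dots\subseteq\mathcal{C}$ with $S_i=g_iS\setminus(S_1\cup\dots\cup S_{i-1})$ for automorphisms $g_i$ of $\Lambda_{24}$ and $$|S_i|\ \ge\ |S|\Bigl(1-\tfrac{1}{196560}\textstyle\sum_{j<i}|S_j|\Bigr)\qquad(i\ge1),$$ such that the following holds for each $$(d,a,b)\in\{(1,0,1),(2,2,0),(3,2,3),(4,8,0),(5,8,8),(6,24,0),(7,24,27)\}.$$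 There is a kissing configuration on the unit sphere of $\mathbb{R}^d$ partitioned into $T_1,\dots,T_{a+b}$, with $|T_i|=3$ for $i\le a$, $|T_i|=2$ for $i>a$, and $\langle x,y\rangle\le-\tfrac12$ for distinct $x,y$ in the same $T_i$, such that $$\Bigl\{(x,0):x\in\mathcal{C}\setminus\bigcup_{i=1}^{a+b}S_i\Bigr\}\cup\bigcup_{i=1}^{a+b}\Bigl\{\bigl(\sqrt{2/3}\,x,\sqrt{4/3}\,y\bigr):x\in S_i,\ y\in T_i\Bigr\}\subset\mathbb{R}^{24}\times\mathbb{R}^d$$ is a kissing configuration on the sphere of radius $2$ with exactly $$B_d=196560+2\sum_{i=1}^{a}|S_i|+\sum_{i=a+1}^{a+b}|S_i|$$ points. If $S$ is antipodal and $|S|=480$, then $B_1,\dots,B_7$ are at least the numbers in (1), respectively. If $S$ is antipodal and $|S|=288$, then $B_1,\dots,B_7$ are at least $$196848,\ 197712,\ 198576,\ 201156,\ 203430,\ 210200,\ 217588,$$ respectively, each of which exceeds the corresponding previous record (from 1982, achieved by laminated lattices) $$196656,\ 196848,\ 197142,\ 197736,\ 198506,\ 200046,\ 202692.$$ -/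

import Mathlib

open scoped BigOperators

noncomputable section

/-- A kissing configuration on the sphere of radius `r` about the origin: points of that sphere
any two of which are separated by an angle of at least `π / 3`. -/
def IsKissingConfiguration {E : Type*} [NormedAddCommGroup E] [InnerProductSpace ℝ E]
    (r : ℝ) (T : Set E) : Prop :=
  (∀ x ∈ T, ‖x‖ = r) ∧
    ∀ x ∈ T, ∀ y ∈ T, x ≠ y → Real.pi / 3 ≤ InnerProductGeometry.angle x y

/-- The kissing number in dimension `n`: the largest size of a kissing configuration on the unit
sphere of `ℝⁿ`, as an extended natural number. -/
def kissingNumber (n : ℕ) : ℕ∞ :=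
  ⨆ T : {T : Set (EuclideanSpace ℝ (Fin n)) // IsKissingConfiguration 1 T}, T.1.encard

/-- Row `i` of a generator matrix of the extended binary Golay code: the `i`-th shift of the
generator polynomial `1 + X + X⁵ + X⁶ + X⁷ + X⁹ + X¹¹` on the coordinates `0, …, 22`, with the
parity bit in coordinate `23`. -/
def golayRow (i : Fin 12) : Fin 24 → ZMod 2 := fun j =>
  if j.val = 23 ∨ ∃ k ∈ ({0, 1, 5, 6, 7, 9, 11} : Finset ℕ), j.val = k + i.val then 1 else 0

/-- The extended binary Golay code. -/
def golayCode : Submodule (ZMod 2) (Fin 24 → ZMod 2) :=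
  Submodule.span (ZMod 2) (Set.range golayRow)

/-- The Leech lattice: the vectors `x / √8` with `x ∈ ℤ²⁴` such that, for some integer `m`, all
coordinates of `x` are congruent to `m` modulo `2`, the positions `i` at which `(x i - m) / 2` is
odd form a Golay codeword, and the sum of the coordinates is congruent to `4 m` modulo `8`. -/
def leechLattice : AddSubgroup (EuclideanSpace ℝ (Fin 24)) where
  carrier := {v | ∃ (m : ℤ) (c : Fin 24 → ℤ),
    (∀ i, v i = ((m + 2 * c i : ℤ) : ℝ) / Real.sqrt 8) ∧
    (fun i => (c i : ZMod 2)) ∈ golayCode ∧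
    (∑ i, (m + 2 * c i)) ≡ 4 * m [ZMOD 8]}
  zero_mem' := by
    refine ⟨0, 0, by simp, ?_, by simp⟩
    convert golayCode.zero_mem using 1
    ext i
    simp
  add_mem' := by
    rintro v w ⟨m, c, hv, hc, hm⟩ ⟨n, d, hw, hd, hn⟩
    refine ⟨m + n, c + d, fun i => ?_, ?_, ?_⟩
    · rw [PiLp.add_apply, hv i, hw i]
      simp only [Pi.add_apply]
      push_cast
      ring
    · convert golayCode.add_mem hc hd using 1
      ext i
      simp
    · have h : ∑ i, (m + n + 2 * (c + d) i) = ∑ i, (m + 2 * c i) + ∑ i, (n + 2 * d i) := by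
        rw [← Finset.sum_add_distrib]
        refine Finset.sum_congr rfl fun i _ => ?_
        simp only [Pi.add_apply]
        ring
      rw [h, mul_add]
      exact hm.add hn
  neg_mem' := by
    rintro v ⟨m, c, hv, hc, hm⟩
    refine ⟨-m, -c, fun i => ?_, ?_, ?_⟩
    · rw [PiLp.neg_apply, hv i]
      simp only [Pi.neg_apply]
      push_cast
      ring
    · convert golayCode.neg_mem hc using 1
      ext i
      simp
    · have h : ∑ i, (-m + 2 * (-c) i) = -∑ i, (m + 2 * c i) := by
        rw [← Finset.sum_neg_distrib]
        refine Finset.sum_congr rfl fun i _ => ?_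
        simp only [Pi.neg_apply]
        ring
      rw [h, mul_neg]
      exact hm.neg

/-- The minimal vectors of the Leech lattice, those of squared length `4`. -/
def leechMinimalVectors : Set (EuclideanSpace ℝ (Fin 24)) :=
  {v | v ∈ leechLattice ∧ ‖v‖ ^ 2 = 4}

/-- A set of minimal vectors of the Leech lattice whose distinct elements have inner product at
most `1`. -/
def IsAdmissible (S : Set (EuclideanSpace ℝ (Fin 24))) : Prop :=
  S ⊆ leechMinimalVectors ∧ ∀ x ∈ S, ∀ y ∈ S, x ≠ y → inner ℝ x y ≤ (1 : ℝ)

/-- A set that contains the negative of each of its elements. -/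
def IsAntipodal (S : Set (EuclideanSpace ℝ (Fin 24))) : Prop :=
  ∀ x ∈ S, -x ∈ S

/-- The sets `A 0 = S, A 1, A 2, …` are obtained by successively taking images of `S` under
automorphisms of the Leech lattice and removing the points that were used already, in such a way
that no overlap is larger than the average one. -/
def IsTranslateSequence (S : Set (EuclideanSpace ℝ (Fin 24)))
    (A : ℕ → Set (EuclideanSpace ℝ (Fin 24))) : Prop :=
  A 0 = S ∧
  (∀ i, ∃ g : EuclideanSpace ℝ (Fin 24) ≃ₗᵢ[ℝ] EuclideanSpace ℝ (Fin 24),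
    g '' (leechLattice : Set (EuclideanSpace ℝ (Fin 24))) = leechLattice ∧
    A i = (g '' S) \ ⋃ j < i, A j) ∧
  ∀ i, (S.ncard : ℝ) * (1 - (∑ j ∈ Finset.range i, ((A j).ncard : ℝ)) / 196560) ≤ (A i).ncard

/-- A kissing configuration on the unit sphere of `ℝᵈ` that is the disjoint union of `T 0, T 1, …`,
where the first `a` parts have three points, the other `b` parts have two points, and distinct
points of one part have inner product at most `-1/2`. -/
def IsPartitionedKissing (d a b : ℕ) (T : Fin (a + b) → Set (EuclideanSpace ℝ (Fin d))) : Prop :=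
  IsKissingConfiguration 1 (⋃ i, T i) ∧
  Pairwise (fun i j => Disjoint (T i) (T j)) ∧
  (∀ i, (T i).ncard = if i.val < a then 3 else 2) ∧
  ∀ i, ∀ x ∈ T i, ∀ y ∈ T i, x ≠ y → inner ℝ x y ≤ (-1 / 2 : ℝ)

/-- The modified configuration in `ℝ²⁴ × ℝᵈ` (with the Euclidean norm): the points `(x, 0)` for the
minimal vectors `x` outside all `A i`, and the points `(√(2/3) x, √(4/3) y)` with `x ∈ A i` and
`y ∈ T i`. -/
def liftedConfiguration {d N : ℕ} (A : ℕ → Set (EuclideanSpace ℝ (Fin 24)))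
    (T : Fin N → Set (EuclideanSpace ℝ (Fin d))) :
    Set (WithLp 2 (EuclideanSpace ℝ (Fin 24) × EuclideanSpace ℝ (Fin d))) :=
  {p | ∃ x ∈ leechMinimalVectors \ ⋃ i : Fin N, A i.val, p = WithLp.toLp 2 (x, 0)} ∪
  {p | ∃ i : Fin N, ∃ x ∈ A i.val, ∃ y ∈ T i,
    p = WithLp.toLp 2 (Real.sqrt (2 / 3) • x, Real.sqrt (4 / 3) • y)}

/-- `196560 + 2 (|A 0| + … + |A (a-1)|) + (|A a| + … + |A (a+b-1)|)`. -/
def kissingBound (A : ℕ → Set (EuclideanSpace ℝ (Fin 24))) (a b : ℕ) : ℕ :=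
  196560 + 2 * ∑ i ∈ Finset.range a, (A i).ncard + ∑ i ∈ Finset.Ico a (a + b), (A i).ncard

/-- The sets `A i` give, by means of a suitable partitioned kissing configuration in `ℝᵈ` with `a`
triples and `b` pairs, a kissing configuration (on the sphere of radius `2`) in dimension `24 + d`
with exactly `kissingBound A a b` points. -/
def RealizesBound (A : ℕ → Set (EuclideanSpace ℝ (Fin 24))) (d a b : ℕ) : Prop :=
  ∃ T : Fin (a + b) → Set (EuclideanSpace ℝ (Fin d)),
    IsPartitionedKissing d a b T ∧
    IsKissingConfiguration 2 (liftedConfiguration A T) ∧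
    (liftedConfiguration A T).ncard = kissingBound A a b

end

/-! Distinct minimal vectors of the Leech lattice have inner product at most 2, since their
difference has squared length at least 4. Replace a minimal vector `x` by the points `(√(2/3) x,
√(4/3) y)`, where `y` runs over a set of unit vectors. All squared lengths stay 4, and the inner
product of two new points is `2/3 ⟨x, x'⟩ + 4/3 ⟨y, y'⟩`. This is at most 2 in exactly the
situations that the construction allows: `8/3 - 2/3` for the same `x` and different `y` in one part,
`2/3 + 4/3` for different `x` in one admissible set, and `4/3 + 2/3` for points of different parts.
Points that were not replaced cause no trouble because `√(2/3) ≤ 1`. A vector paired with a triple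
gains two points, one paired with a pair gains one (`isKissingConfiguration_lifted`,
`ncard_lifted`).

To make the disjoint sets large, average over automorphisms. They act transitively on the 196560
minimal vectors, so the mean of `|gS ∩ U|` is `|S| |U| / 196560` and some `g` does at least as well
(`exists_isLeechAut_ncard_inter_le`). If `S` is antipodal, every new set is antipodal and therefore
even in size, so the bound can be rounded up to an even number at each step (`translateBound_le`).

This needs three facts about the lattice: its minimal squared length is 4 (`IntLeech.le_sum_sq`),
there are 196560 minimal vectors (`card_minimalFinset`), and they form one orbit
(`leechConj_of_minimal`). All three follow from the weights 0, 8, 12, 16, 24 of the Golay code, its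
759 octads, and finite checks on eight sextets. Sign changes on codewords and the sextet maps, which
up to sign reflect each tetrad in its all-ones vector, already fuse all shapes of minimal vectors.

The partitioned configurations are the root systems A₁, A₂, A₃, D₄, D₅, E₆, E₇: A₂, D₄ and E₆ split
into triples of roots at angle `2π/3`, and the roots added in the other cases into opposite pairs.
The admissible sets come from one explicit list of 240 vectors together with their negatives. -/

/-! ### The extended binary Golay code as a list of bit masks -/

/-- The exclusive or of the entries of a list selected by the binary digits of `m`. -/
def xorComb : List ℕ → ℕ → ℕ
  | [], _ => 0
  | r :: rs, m => (if m % 2 = 1 then r else 0) ^^^ xorComb rs (m / 2)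

/-- The number of ones among the `k` lowest binary digits. -/
def popCount : ℕ → ℕ → ℕ
  | 0, _ => 0
  | k + 1, n => n % 2 + popCount k (n / 2)

/-- The rows of the generator matrix of the Golay code as bit masks. -/
def golayMasks : List ℕ := (List.range 12).map fun i => 2787 * 2 ^ i + 2 ^ 23

/-- The codeword with message `m` as a bit mask. -/
def golayWord (m : ℕ) : ℕ := xorComb golayMasks m

/-- The message of a codeword; `1183` is the inverse of the generator polynomial modulo `X ^ 12`. -/
def golayDecode (n : ℕ) : ℕ :=
  xorComb ((List.range 12).map fun i => 1183 * 2 ^ i) n % 4096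

/-- The set of positions of the ones of a bit mask. -/
def bits (n : ℕ) : Finset (Fin 24) := Finset.univ.filter fun i => n.testBit i

/-- The indicator word of a set of coordinates. -/
def indWord (s : Finset (Fin 24)) : Fin 24 → ZMod 2 := fun i => if i ∈ s then 1 else 0

/-- The supports of the codewords of the Golay code. -/
def golaySets : Finset (Finset (Fin 24)) := (Finset.range 4096).image fun m => bits (golayWord m)

theorem mem_bits {n : ℕ} {i : Fin 24} : i ∈ bits n ↔ n.testBit i = true := by simp [bits]

theorem indWord_inj {s t : Finset (Fin 24)} (h : indWord s = indWord t) : s = t := by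
  ext i
  have := congrFun h i
  simp only [indWord] at this
  by_cases h1 : i ∈ s <;> by_cases h2 : i ∈ t <;> simp_all

theorem indWord_bits_xor (a b : ℕ) :
    indWord (bits (a ^^^ b)) = indWord (bits a) + indWord (bits b) := by
  ext i
  simp only [indWord, mem_bits, Nat.testBit_xor, Pi.add_apply]
  cases a.testBit i <;> cases b.testBit i <;> (simp; try decide)

theorem indWord_bits_zero : indWord (bits 0) = 0 := by
  ext i; simp [indWord, mem_bits]

/-- Over `ZMod 2` a linear combination is a subset sum, and the binary digits of `m` record the
subset; the induction removes the head of the list together with the lowest digit. -/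
theorem mem_span_indWord (rs : List ℕ) (v : Fin 24 → ZMod 2) :
    v ∈ Submodule.span (ZMod 2) {w | ∃ r ∈ rs, w = indWord (bits r)} ↔
      ∃ m < 2 ^ rs.length, v = indWord (bits (xorComb rs m)) := by
  induction rs generalizing v with
  | nil => simp [xorComb, indWord_bits_zero]
  | cons r rs ih =>
    have h : {w | ∃ x ∈ r :: rs, w = indWord (bits x)} =
        insert (indWord (bits r)) {w | ∃ x ∈ rs, w = indWord (bits x)} := by
      ext w; simp
    rw [h, Submodule.mem_span_insert]
    constructor
    · rintro ⟨a, z, hz, rfl⟩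
      obtain ⟨m, hm, rfl⟩ := (ih z).1 hz
      rw [List.length_cons, pow_succ]
      obtain rfl | rfl : a = 0 ∨ a = 1 := by revert a; decide
      · exact ⟨2 * m, by omega, by simp [xorComb]⟩
      · refine ⟨2 * m + 1, by omega, ?_⟩
        have h2 : (2 * m + 1) / 2 = m := by omega
        have h3 : (2 * m + 1) % 2 = 1 := by omega
        rw [xorComb, h2, if_pos h3, indWord_bits_xor, one_smul]
    · rintro ⟨m, hm, rfl⟩
      rw [List.length_cons, pow_succ] at hm
      refine ⟨if m % 2 = 1 then 1 else 0, _, (ih _).2 ⟨m / 2, by omega, rfl⟩, ?_⟩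
      rw [xorComb, indWord_bits_xor]
      split_ifs <;> simp [indWord_bits_zero]

/-- The number `2787 = 1 + 2 + 32 + 64 + 128 + 512 + 2048` encodes the generator polynomial. It has
seven terms, so the parity bit `2 ^ 23` occurs in every row. -/
theorem golayRow_eq (i : Fin 12) : golayRow i = indWord (bits (2787 * 2 ^ i.val + 2 ^ 23)) := by
  funext j
  simp only [golayRow, indWord, mem_bits]
  revert i j
  decide +kernel

theorem mem_golayCode {v : Fin 24 → ZMod 2} :
    v ∈ golayCode ↔ ∃ m < 4096, v = indWord (bits (golayWord m)) := by
  have h : Set.range golayRow = {w | ∃ r ∈ golayMasks, w = indWord (bits r)} := by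
    ext w
    simp only [Set.mem_range, golayMasks, List.mem_map, List.mem_range, Set.mem_ofPred_eq]
    constructor
    · rintro ⟨i, rfl⟩
      exact ⟨_, ⟨i, i.2, rfl⟩, golayRow_eq i⟩
    · rintro ⟨_, ⟨i, hi, rfl⟩, rfl⟩
      exact ⟨⟨i, hi⟩, golayRow_eq ⟨i, hi⟩⟩
  rw [golayCode, h, mem_span_indWord]
  simp [golayMasks, golayWord]

theorem indWord_mem_golayCode {s : Finset (Fin 24)} : indWord s ∈ golayCode ↔ s ∈ golaySets := by
  rw [mem_golayCode, golaySets, Finset.mem_image]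
  constructor
  · rintro ⟨m, hm, h⟩
    exact ⟨m, Finset.mem_range.2 hm, (indWord_inj h).symm⟩
  · rintro ⟨m, hm, rfl⟩
    exact ⟨m, Finset.mem_range.1 hm, rfl⟩

theorem intCast_eq_indWord (c : Fin 24 → ℤ) :
    (fun i => (c i : ZMod 2)) = indWord (Finset.univ.filter fun i => Odd (c i)) := by
  ext i
  simp only [indWord, Finset.mem_filter, Finset.mem_univ, true_and]
  split_ifs with h
  · exact (ZMod.intCast_eq_one_iff_odd).2 h
  · rw [Int.not_odd_iff_even] at h
    exact (ZMod.intCast_eq_zero_iff_even).2 h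

theorem card_bits (n : ℕ) : (bits n).card = popCount 24 n := by
  have key : ∀ k n, popCount k n = ∑ i ∈ Finset.range k, (n.testBit i).toNat := by
    intro k
    induction k with
    | zero => intro n; simp [popCount]
    | succ k ih =>
      intro n
      rw [popCount, ih, Finset.sum_range_succ', add_comm]
      congr 1
      · refine Finset.sum_congr rfl fun i _ => ?_
        rw [Nat.testBit_succ]
      · rcases Nat.mod_two_eq_zero_or_one n with h | h <;> simp [Nat.testBit_zero, h]
  rw [key, Finset.sum_range fun i => (n.testBit i).toNat, bits, Finset.card_filter]
  refine Finset.sum_congr rfl fun i _ => ?_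
  cases n.testBit i <;> simp

/-! ### Weights and number of the Golay codewords by computation -/

/-- The sum of `f` over the `2 ^ k` numbers from `m * 2 ^ k` on, by repeated bisection. -/
def dyadicSum (f : ℕ → ℕ) : ℕ → ℕ → ℕ
  | 0, m => f m
  | k + 1, m => dyadicSum f k (2 * m) + dyadicSum f k (2 * m + 1)

theorem dyadicSum_eq (f : ℕ → ℕ) (k m : ℕ) :
    dyadicSum f k m = ∑ j ∈ Finset.range (2 ^ k), f (m * 2 ^ k + j) := by
  induction k generalizing m with
  | zero => simp [dyadicSum]
  | succ k ih =>
    rw [dyadicSum, ih, ih, pow_succ, mul_two, Finset.sum_range_add]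
    congr 1 <;> refine Finset.sum_congr rfl fun j _ => congrArg f (by ring)

/-- Two nested quantifiers of length 64 keep the recursion shallow when the 4096 cases are
evaluated. -/
theorem forall_lt_4096 {p : ℕ → Prop} (h : ∀ a < 64, ∀ b < 64, p (64 * a + b)) :
    ∀ m < 4096, p m := by
  intro m hm
  have := h (m / 64) (by omega) (m % 64) (by omega)
  rwa [Nat.div_add_mod] at this

/-- The parity bit does not affect the lowest 12 digits, so the message is recovered by division by
the generator polynomial modulo `X ^ 12`. Hence the 4096 words are distinct. The decoder also gives
a membership test: a mask that survives decoding and re-encoding is a codeword. -/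
theorem golayDecode_golayWord : ∀ m < 4096, golayDecode (golayWord m) = m :=
  forall_lt_4096 (by decide +kernel)

theorem popCount_golayWord : ∀ m < 4096, popCount 24 (golayWord m) ∈ [0, 8, 12, 16, 24] :=
  forall_lt_4096 (by decide +kernel)

theorem dyadicSum_octads :
    dyadicSum (fun m => if popCount 24 (golayWord m) = 8 then 1 else 0) 12 0 = 759 := by
  decide +kernel

theorem golayWord_lt : ∀ m < 4096, golayWord m < 2 ^ 24 :=
  forall_lt_4096 (by decide +kernel)

theorem bits_inj {m n : ℕ} (hm : m < 2 ^ 24) (hn : n < 2 ^ 24) (h : bits m = bits n) : m = n := by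
  refine Nat.eq_of_testBit_eq fun i => ?_
  by_cases hi : i < 24
  · have := congrArg (fun s => (⟨i, hi⟩ : Fin 24) ∈ s) h
    simp only [mem_bits, eq_iff_iff] at this
    exact Bool.eq_iff_iff.2 this
  · have h24 : 2 ^ 24 ≤ 2 ^ i := Nat.pow_le_pow_right (by norm_num) (by omega)
    rw [Nat.testBit_eq_false_of_lt (hm.trans_le h24), Nat.testBit_eq_false_of_lt (hn.trans_le h24)]

theorem injOn_bits_golayWord :
    Set.InjOn (fun m => bits (golayWord m)) (Finset.range 4096 : Finset ℕ) := by
  intro m hm n hn h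
  have hm' : m < 4096 := by simpa using hm
  have hn' : n < 4096 := by simpa using hn
  rw [← golayDecode_golayWord m hm', ← golayDecode_golayWord n hn',
    bits_inj (golayWord_lt m hm') (golayWord_lt n hn') h]

theorem card_golaySets : golaySets.card = 4096 := by
  rw [golaySets, Finset.card_image_of_injOn injOn_bits_golayWord, Finset.card_range]

theorem card_octads : (golaySets.filter fun s => s.card = 8).card = 759 := by
  rw [← dyadicSum_octads, dyadicSum_eq, golaySets, Finset.filter_image, Finset.card_image_of_injOn,
    Finset.card_filter]
  · refine Finset.sum_congr (by norm_num) fun m _ => ?_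
    simp only [card_bits, zero_mul, zero_add]
  · exact injOn_bits_golayWord.mono fun m hm => by
      rw [Finset.mem_coe, Finset.mem_filter] at hm; exact hm.1

theorem card_golaySet {s : Finset (Fin 24)} (hs : s ∈ golaySets) :
    s.card = 0 ∨ s.card = 8 ∨ s.card = 12 ∨ s.card = 16 ∨ s.card = 24 := by
  obtain ⟨m, hm, rfl⟩ := Finset.mem_image.1 hs
  have := popCount_golayWord m (Finset.mem_range.1 hm)
  rw [card_bits]
  simpa using this

theorem four_dvd_card_golaySet {s : Finset (Fin 24)} (hs : s ∈ golaySets) : 4 ∣ s.card := by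
  rcases card_golaySet hs with h | h | h | h | h <;> rw [h] <;> norm_num

/-- Codewords meet evenly. -/
theorem even_card_inter {s t : Finset (Fin 24)} (hs : s ∈ golaySets) (ht : t ∈ golaySets) :
    Even (s ∩ t).card := by
  have h : indWord (symmDiff s t) = indWord s + indWord t := by
    ext i
    simp only [indWord, Finset.mem_symmDiff, Pi.add_apply]
    by_cases h1 : i ∈ s <;> by_cases h2 : i ∈ t <;> simp [h1, h2]
    decide
  have h1 : symmDiff s t ∈ golaySets := by
    rw [← indWord_mem_golayCode, h]
    exact golayCode.add_mem (indWord_mem_golayCode.2 hs) (indWord_mem_golayCode.2 ht)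
  have h2 := four_dvd_card_golaySet h1
  have h3 := four_dvd_card_golaySet hs
  have h4 := four_dvd_card_golaySet ht
  -- All three weights in this identity are multiples of 4, which makes the intersection even.
  have h5 : (symmDiff s t).card + 2 * (s ∩ t).card = s.card + t.card := by
    have e1 := Finset.card_sdiff_add_card_inter s t
    have e2 := Finset.card_sdiff_add_card_inter t s
    rw [Finset.inter_comm t s] at e2
    have e3 : (symmDiff s t).card = (s \ t).card + (t \ s).card := by
      rw [symmDiff_def, Finset.sup_eq_union, Finset.card_union_of_disjoint disjoint_sdiff_sdiff]
    omega
  rw [even_iff_two_dvd]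
  omega

/-! ### The Leech lattice in integral coordinates -/

/-- The integral vectors `x` such that `x / √8` lies in the Leech lattice. -/
def IntLeech (x : Fin 24 → ℤ) : Prop :=
  ∃ (m : ℤ) (c : Fin 24 → ℤ), (∀ i, x i = m + 2 * c i) ∧
    (fun i => (c i : ZMod 2)) ∈ golayCode ∧ ∑ i, x i ≡ 4 * m [ZMOD 8]

/-- The vector `x / √8`. -/
noncomputable def toE (x : Fin 24 → ℤ) : EuclideanSpace ℝ (Fin 24) :=
  WithLp.toLp 2 fun i => (x i : ℝ) / Real.sqrt 8

theorem toE_apply (x : Fin 24 → ℤ) (i : Fin 24) : toE x i = (x i : ℝ) / Real.sqrt 8 := rfl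

theorem mem_leechLattice {v : EuclideanSpace ℝ (Fin 24)} :
    v ∈ leechLattice ↔ ∃ x, IntLeech x ∧ toE x = v := by
  constructor
  · rintro ⟨m, c, h, hc, hs⟩
    refine ⟨fun i => m + 2 * c i, ⟨m, c, fun i => rfl, hc, hs⟩, ?_⟩
    ext i
    rw [h i, toE_apply]
  · rintro ⟨x, ⟨m, c, h, hc, hs⟩, rfl⟩
    refine ⟨m, c, fun i => by rw [toE_apply, h i], hc, ?_⟩
    simpa only [h] using hs

theorem inner_toE (x y : Fin 24 → ℤ) :
    inner ℝ (toE x) (toE y) = ((∑ i, x i * y i : ℤ) : ℝ) / 8 := by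
  have h8 : Real.sqrt 8 * Real.sqrt 8 = 8 := Real.mul_self_sqrt (by norm_num)
  rw [PiLp.inner_apply]
  push_cast
  rw [Finset.sum_div]
  refine Finset.sum_congr rfl fun i _ => ?_
  rw [toE_apply, toE_apply, real_inner_eq_re_inner, RCLike.inner_apply]
  simp only [conj_trivial, RCLike.re_to_real]
  rw [div_mul_div_comm, h8, mul_comm]

theorem norm_sq_toE (x : Fin 24 → ℤ) : ‖toE x‖ ^ 2 = ((∑ i, x i ^ 2 : ℤ) : ℝ) / 8 := by
  rw [← real_inner_self_eq_norm_sq, inner_toE]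
  simp only [sq]

theorem toE_injective : Function.Injective toE := by
  intro x y h
  ext i
  have h1 : toE x i = toE y i := by rw [h]
  rw [toE_apply, toE_apply] at h1
  have : Real.sqrt 8 ≠ 0 := by positivity
  field_simp at h1
  exact_mod_cast h1

theorem toE_zero : toE 0 = 0 := by
  ext i
  simp [toE_apply]

theorem mem_leechMinimalVectors {v : EuclideanSpace ℝ (Fin 24)} :
    v ∈ leechMinimalVectors ↔ ∃ x, (IntLeech x ∧ ∑ i, x i ^ 2 = 32) ∧ toE x = v := by
  have key : ∀ x, ‖toE x‖ ^ 2 = 4 ↔ ∑ i, x i ^ 2 = 32 := by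
    intro x
    rw [norm_sq_toE, div_eq_iff (by norm_num)]
    norm_num
    norm_cast
  constructor
  · rintro ⟨h, h4⟩
    obtain ⟨x, hx, rfl⟩ := mem_leechLattice.1 h
    exact ⟨x, ⟨hx, (key x).1 h4⟩, rfl⟩
  · rintro ⟨x, ⟨hx, h⟩, rfl⟩
    exact ⟨mem_leechLattice.2 ⟨x, hx, rfl⟩, (key x).2 h⟩

/-- The positions of the odd entries. -/
def oddSet (c : Fin 24 → ℤ) : Finset (Fin 24) := Finset.univ.filter fun i => Odd (c i)

theorem mem_oddSet {c : Fin 24 → ℤ} {i : Fin 24} : i ∈ oddSet c ↔ Odd (c i) := by simp [oddSet]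

theorem cast_mem_golayCode {c : Fin 24 → ℤ} :
    (fun i => (c i : ZMod 2)) ∈ golayCode ↔ oddSet c ∈ golaySets := by
  rw [intCast_eq_indWord, indWord_mem_golayCode, oddSet]

theorem univ_mem_golaySets : Finset.univ ∈ golaySets := by
  have h : golayWord (golayDecode (2 ^ 24 - 1)) = 2 ^ 24 - 1 := by decide +kernel
  refine Finset.mem_image.2 ⟨golayDecode (2 ^ 24 - 1), ?_, ?_⟩
  · exact Finset.mem_range.2 (Nat.mod_lt _ (by norm_num))
  · rw [h]
    decide +kernel

/-- Because of the constant words, `c` may be shifted by an integer, which reduces the integer `m`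
in `IntLeech` to 0 or 1. -/
theorem const_mem_golayCode (k : ZMod 2) : (fun _ => k) ∈ golayCode := by
  have h := golayCode.smul_mem k (indWord_mem_golayCode.2 univ_mem_golaySets)
  convert h using 1
  ext i
  simp [indWord]

/-- The two kinds of vectors of the Leech lattice: even and odd ones. -/
theorem intLeech_iff {x : Fin 24 → ℤ} : IntLeech x ↔
    (∃ c : Fin 24 → ℤ, (∀ i, x i = 2 * c i) ∧ oddSet c ∈ golaySets ∧ 4 ∣ ∑ i, c i) ∨
    (∃ c : Fin 24 → ℤ, (∀ i, x i = 1 + 2 * c i) ∧ oddSet c ∈ golaySets ∧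
      ∑ i, x i ≡ 4 [ZMOD 8]) := by
  constructor
  · rintro ⟨m, c, h, hc, hs⟩
    have hw : ∀ k : ℤ, oddSet (fun i => k + c i) ∈ golaySets := by
      intro k
      rw [← cast_mem_golayCode]
      convert golayCode.add_mem (const_mem_golayCode k) hc using 1
      ext i
      simp
    obtain ⟨k, rfl⟩ | ⟨k, rfl⟩ := Int.even_or_odd m
    · refine Or.inl ⟨fun i => k + c i, fun i => by rw [h i]; ring, hw k, ?_⟩
      have h1 : ∑ i, x i = 2 * ∑ i, (k + c i) := by
        rw [Finset.mul_sum]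
        exact Finset.sum_congr rfl fun i _ => by rw [h i]; ring
      rw [h1, Int.ModEq] at hs
      change 4 ∣ ∑ i, (k + c i)
      omega
    · refine Or.inr ⟨fun i => k + c i, fun i => by rw [h i]; ring, hw k, ?_⟩
      rw [Int.ModEq] at hs ⊢
      omega
  · rintro (⟨c, h, hc, hs⟩ | ⟨c, h, hc, hs⟩)
    · refine ⟨0, c, fun i => by rw [h i]; ring, cast_mem_golayCode.2 hc, ?_⟩
      have h1 : ∑ i, x i = 2 * ∑ i, c i := by
        rw [Finset.mul_sum]
        exact Finset.sum_congr rfl fun i _ => h i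
      rw [h1, Int.ModEq]
      omega
    · exact ⟨1, c, h, cast_mem_golayCode.2 hc, by simpa using hs⟩

theorem card_le_sum_sq_oddSet (c : Fin 24 → ℤ) :
    ((oddSet c).card : ℤ) ≤ ∑ i ∈ oddSet c, c i ^ 2 := by
  rw [Finset.card_eq_sum_ones, Nat.cast_sum]
  refine Finset.sum_le_sum fun i hi => ?_
  have h : c i ≠ 0 := by
    intro h0
    rw [mem_oddSet, h0] at hi
    exact absurd hi (by decide)
  have : 0 < c i ^ 2 := by positivity
  push_cast
  omega

theorem sum_sq_oddSet_add (c : Fin 24 → ℤ) :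
    ∑ i ∈ oddSet c, c i ^ 2 + ∑ i ∈ (oddSet c)ᶜ, c i ^ 2 = ∑ i, c i ^ 2 :=
  Finset.sum_add_sum_compl _ _

theorem exists_eq_two_mul {c : Fin 24 → ℤ} (h : (oddSet c).card = 0) :
    ∃ b : Fin 24 → ℤ, ∀ i, c i = 2 * b i := by
  have h1 : ∀ i, ∃ b, c i = 2 * b := by
    intro i
    have : i ∉ oddSet c := by rw [Finset.card_eq_zero.1 h]; simp
    rw [mem_oddSet, Int.not_odd_iff_even, even_iff_two_dvd] at this
    exact this
  exact Classical.skolem.1 h1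

theorem sum_odd_mod {c : Fin 24 → ℤ} {s : Finset (Fin 24)} :
    (∑ i ∈ s, c i) % 2 = ((s ∩ oddSet c).card : ℤ) % 2 := by
  have h : ((∑ i ∈ s, c i : ℤ) : ZMod 2) = (((s ∩ oddSet c).card : ℤ) : ZMod 2) := by
    push_cast
    rw [Finset.card_eq_sum_ones, ← Finset.filter_mem_eq_inter, Finset.sum_filter]
    push_cast
    refine Finset.sum_congr rfl fun i _ => ?_
    have := congrFun (intCast_eq_indWord c) i
    simpa [indWord, oddSet] using this
  have := (ZMod.intCast_eq_intCast_iff _ _ _).1 h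
  exact this

/-- The nonzero vectors of the Leech lattice have squared length at least `4`. -/
theorem IntLeech.le_sum_sq {x : Fin 24 → ℤ} (hx : IntLeech x) (h0 : x ≠ 0) :
    32 ≤ ∑ i, x i ^ 2 := by
  rcases intLeech_iff.1 hx with ⟨c, h, hc, hs⟩ | ⟨c, h, hc, hs⟩
  · have h1 : ∑ i, x i ^ 2 = 4 * ∑ i, c i ^ 2 := by
      rw [Finset.mul_sum]
      exact Finset.sum_congr rfl fun i _ => by rw [h i]; ring
    by_cases hw : (oddSet c).card = 0
    · obtain ⟨b, hb⟩ := exists_eq_two_mul hw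
      have h2 : ∑ i, c i ^ 2 = 4 * ∑ i, b i ^ 2 := by
        rw [Finset.mul_sum]
        exact Finset.sum_congr rfl fun i _ => by rw [hb i]; ring
      have h3 : ∑ i, c i = 2 * ∑ i, b i := by
        rw [Finset.mul_sum]
        exact Finset.sum_congr rfl fun i _ => hb i
      -- Here `x = 4 b`, and the condition on the sum makes `∑ b i` even. Squares have the parity of
      -- their bases, so `∑ b i ^ 2` is even and positive, hence at least 2, and `16 * 2 = 32`.
      have h4 : (2 : ℤ) ∣ ∑ i, b i ^ 2 - ∑ i, b i := by
        rw [← Finset.sum_sub_distrib]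
        refine Finset.dvd_sum fun i _ => ?_
        have := Int.even_mul_pred_self (b i)
        rw [even_iff_two_dvd] at this
        convert this using 1
        ring
      have h5 : 0 < ∑ i, b i ^ 2 := by
        obtain ⟨i, hi⟩ := Function.ne_iff.1 h0
        refine Finset.sum_pos' (fun i _ => sq_nonneg _) ⟨i, Finset.mem_univ _, ?_⟩
        have : b i ≠ 0 := by
          intro hbi
          exact hi (by rw [h i, hb i, hbi]; rfl)
        positivity
      omega
    -- A nonzero codeword has weight at least 8, so at least eight entries `2 * c i` have square at
    -- least 4.
    · have h2 := card_le_sum_sq_oddSet c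
      have h3 := sum_sq_oddSet_add c
      have h4 : 0 ≤ ∑ i ∈ (oddSet c)ᶜ, c i ^ 2 := Finset.sum_nonneg fun i _ => sq_nonneg _
      have h5 := card_golaySet hc
      omega
  -- An odd square is 1 plus 8 times a triangular number. A sum below 32 would thus be 24, with all
  -- entries `±1`. Their sum is then 24 minus twice a weight divisible by 4, hence 0 and not 4
  -- modulo 8.
  · have h1 : ∑ i, x i ^ 2 = 24 + 8 * ∑ i, c i * (c i + 1) / 2 := by
      rw [Finset.mul_sum]
      have : (24 : ℤ) = ∑ i : Fin 24, 1 := by simp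
      rw [this, ← Finset.sum_add_distrib]
      refine Finset.sum_congr rfl fun i _ => ?_
      have := Int.even_mul_succ_self (c i)
      rw [even_iff_two_dvd] at this
      obtain ⟨k, hk⟩ := this
      rw [hk, Int.mul_ediv_cancel_left _ (by norm_num), h i]
      linear_combination 4 * hk
    have h2 : ∀ i ∈ Finset.univ, 0 ≤ c i * (c i + 1) / 2 := by
      intro i _
      refine Int.ediv_nonneg ?_ (by norm_num)
      rcases le_or_gt 0 (c i) with h | h
      · positivity
      · exact mul_nonneg_of_nonpos_of_nonpos (by omega) (by omega)
    by_contra hlt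
    have h3 : ∑ i, c i * (c i + 1) / 2 = 0 := by
      have := Finset.sum_nonneg h2
      omega
    have h4 := (Finset.sum_eq_zero_iff_of_nonneg h2).1 h3
    have h5 : ∀ i, c i = if i ∈ oddSet c then -1 else 0 := by
      intro i
      have h6 := h4 i (Finset.mem_univ i)
      have h7 := Int.even_mul_succ_self (c i)
      have h8 : c i * (c i + 1) = 0 := by
        rw [even_iff_two_dvd] at h7
        omega
      rcases mul_eq_zero.1 h8 with h9 | h9
      · simp [mem_oddSet, h9]
      · have : c i = -1 := by omega
        simp [mem_oddSet, this]
    have h6 : ∑ i, x i = 24 - 2 * ((oddSet c).card : ℤ) := by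
      have e1 : ∑ i, c i = -((oddSet c).card : ℤ) := by
        rw [Finset.sum_congr rfl fun i _ => h5 i]
        simp
      have e2 : ∑ i, x i = 24 + 2 * ∑ i, c i := by
        rw [Finset.mul_sum]
        have : (24 : ℤ) = ∑ i : Fin 24, 1 := by simp
        rw [this, ← Finset.sum_add_distrib]
        exact Finset.sum_congr rfl fun i _ => h i
      rw [e2, e1]
      ring
    have h7 := four_dvd_card_golaySet hc
    rw [h6, Int.ModEq] at hs
    omega

/-- Distinct minimal vectors have inner product at most `2`. -/
theorem inner_le_two {v w : EuclideanSpace ℝ (Fin 24)} (hv : v ∈ leechMinimalVectors)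
    (hw : w ∈ leechMinimalVectors) (h : v ≠ w) : inner ℝ v w ≤ (2 : ℝ) := by
  -- The difference is a nonzero lattice vector of squared length `8 - 2 ⟨v, w⟩`, which must be at
  -- least 4.
  obtain ⟨x, hx, hxv⟩ := mem_leechLattice.1 (leechLattice.sub_mem hv.1 hw.1)
  have h0 : x ≠ 0 := by
    rintro rfl
    rw [toE_zero] at hxv
    exact h (sub_eq_zero.1 hxv.symm)
  have h1 := norm_sq_toE x
  have h2 : (32 : ℝ) ≤ ((∑ i, x i ^ 2 : ℤ) : ℝ) := by exact_mod_cast hx.le_sum_sq h0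
  have h3 := norm_sub_sq_real v w
  rw [hv.2, hw.2, ← hxv, h1] at h3
  linarith

theorem norm_of_mem_minimal {v : EuclideanSpace ℝ (Fin 24)} (hv : v ∈ leechMinimalVectors) :
    ‖v‖ = 2 := by
  have := hv.2
  nlinarith [norm_nonneg v]

/-! ### The minimal vectors -/

/-- The vector with entries `-k` on `p ∩ t`, `k` on `p \ t` and `0` elsewhere. -/
def signedVec (k : ℤ) (p t : Finset (Fin 24)) : Fin 24 → ℤ :=
  fun i => if i ∈ p then if i ∈ t then -k else k else 0

/-- The vector with an entry `-3` in position `i` and ones elsewhere, with its signs changed on `w`. -/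
def oddVec (w : Finset (Fin 24)) (i : Fin 24) : Fin 24 → ℤ :=
  fun j => (if j ∈ w then -1 else 1) * if j = i then -3 else 1

theorem sum_signedVec (k : ℤ) {p t : Finset (Fin 24)} (ht : t ⊆ p) :
    ∑ i, signedVec k p t i = k * (p.card - 2 * t.card) := by
  have h : ∀ i, signedVec k p t i = (if i ∈ p then k else 0) - 2 * (if i ∈ t then k else 0) := by
    intro i
    have := @ht i
    by_cases h1 : i ∈ t <;> by_cases h2 : i ∈ p <;> simp_all [signedVec]
    ring
  rw [Finset.sum_congr rfl fun i _ => h i, Finset.sum_sub_distrib, ← Finset.mul_sum]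
  simp
  ring

theorem sum_sq_signedVec (k : ℤ) (p t : Finset (Fin 24)) :
    ∑ i, signedVec k p t i ^ 2 = k ^ 2 * p.card := by
  have h : ∀ i, signedVec k p t i ^ 2 = if i ∈ p then k ^ 2 else 0 := by
    intro i
    by_cases h1 : i ∈ t <;> by_cases h2 : i ∈ p <;> simp_all [signedVec]
  rw [Finset.sum_congr rfl fun i _ => h i]
  simp
  ring

theorem sum_oddVec (w : Finset (Fin 24)) (i : Fin 24) :
    ∑ j, oddVec w i j = 24 - 2 * w.card - 4 * if i ∈ w then -1 else 1 := by
  have h : ∀ j, oddVec w i j =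
      1 - 2 * (if j ∈ w then 1 else 0) - 4 * (if j = i then (if i ∈ w then -1 else 1) else 0) := by
    intro j
    by_cases h1 : j = i
    · subst h1
      by_cases h2 : j ∈ w <;> simp [oddVec, h2]
    · by_cases h2 : j ∈ w <;> simp [oddVec, h2, h1]
  rw [Finset.sum_congr rfl fun i _ => h i, Finset.sum_sub_distrib, Finset.sum_sub_distrib,
    ← Finset.mul_sum, ← Finset.mul_sum]
  simp

theorem sum_sq_oddVec (w : Finset (Fin 24)) (i : Fin 24) : ∑ j, oddVec w i j ^ 2 = 32 := by
  have h : ∀ j, oddVec w i j ^ 2 = 1 + if j = i then 8 else 0 := by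
    intro j
    by_cases h1 : j = i <;> by_cases h2 : j ∈ w <;> simp [oddVec, h1, h2]
  rw [Finset.sum_congr rfl fun i _ => h i, Finset.sum_add_distrib]
  simp

theorem empty_mem_golaySets : ∅ ∈ golaySets := by
  rw [← indWord_mem_golayCode]
  convert golayCode.zero_mem using 1
  ext i
  simp [indWord]

theorem intLeech_signedVec_four {p t : Finset (Fin 24)} (hp : p.card = 2) (ht : t ⊆ p) :
    IntLeech (signedVec 4 p t) := by
  refine intLeech_iff.2 (Or.inl ⟨signedVec 2 p t, fun i => ?_, ?_, ?_⟩)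
  · simp only [signedVec]
    split_ifs <;> rfl
  · have : oddSet (signedVec 2 p t) = ∅ := by
      ext i
      simp only [mem_oddSet, signedVec, Finset.notMem_empty, iff_false]
      split_ifs <;> decide
    rw [this]
    exact empty_mem_golaySets
  · rw [sum_signedVec 2 ht, hp]
    push_cast
    omega

theorem intLeech_signedVec_two {p t : Finset (Fin 24)} (hp : p ∈ golaySets) (h8 : p.card = 8)
    (ht : t ⊆ p) (he : Even t.card) : IntLeech (signedVec 2 p t) := by
  refine intLeech_iff.2 (Or.inl ⟨signedVec 1 p t, fun i => ?_, ?_, ?_⟩)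
  · simp only [signedVec]
    split_ifs <;> rfl
  · have : oddSet (signedVec 1 p t) = p := by
      ext i
      simp only [mem_oddSet, signedVec]
      split_ifs with h1 h2 <;> simp [h1]
    rwa [this]
  · rw [sum_signedVec 1 ht, h8]
    obtain ⟨k, hk⟩ := he
    rw [hk]
    push_cast
    omega

theorem intLeech_oddVec {w : Finset (Fin 24)} (hw : w ∈ golaySets) (i : Fin 24) :
    IntLeech (oddVec w i) := by
  -- This is `(x j - 1) / 2` for the entries `3, -1, -3, 1`; it is odd precisely on `w`.
  refine intLeech_iff.2 (Or.inr ⟨fun j => if j ∈ w then if j = i then 1 else -1 else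
    if j = i then -2 else 0, fun j => ?_, ?_, ?_⟩)
  · simp only [oddVec]
    split_ifs <;> rfl
  · convert hw
    ext j
    simp only [mem_oddSet]
    split_ifs with h1 h2 h3 <;> simp [h1]
  · rw [sum_oddVec, Int.ModEq]
    have := four_dvd_card_golaySet hw
    split_ifs <;> omega

/-- A vector with entries in `{-k, 0, k}` is determined by two sets. -/
theorem eq_signedVec {x : Fin 24 → ℤ} {k : ℤ} (h : ∀ i, x i = 0 ∨ x i = k ∨ x i = -k) :
    x = signedVec k (Finset.univ.filter fun i => x i ≠ 0)
      (Finset.univ.filter fun i => x i ≠ 0 ∧ x i = -k) := by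
  ext i
  simp only [signedVec, Finset.mem_filter, Finset.mem_univ, true_and]
  rcases h i with h | h | h <;> split_ifs <;> simp_all

/-- The even minimal vectors of shape `(±4)², 0²²`, the ones of shape `(±2)⁸, 0¹⁶`, and the odd
ones. -/
theorem minimal_cases {x : Fin 24 → ℤ} (hx : IntLeech x) (h32 : ∑ i, x i ^ 2 = 32) :
    (∃ p t : Finset (Fin 24), p.card = 2 ∧ t ⊆ p ∧ x = signedVec 4 p t) ∨
    (∃ p t : Finset (Fin 24), p ∈ golaySets ∧ p.card = 8 ∧ t ⊆ p ∧ Even t.card ∧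
      x = signedVec 2 p t) ∨
    ∃ w ∈ golaySets, ∃ i, x = oddVec w i := by
  rcases intLeech_iff.1 hx with ⟨c, h, hc, hs⟩ | ⟨c, h, hc, hs⟩
  · have h1 : ∑ i, x i ^ 2 = 4 * ∑ i, c i ^ 2 := by
      rw [Finset.mul_sum]
      exact Finset.sum_congr rfl fun i _ => by rw [h i]; ring
    by_cases hw : (oddSet c).card = 0
    · left
      obtain ⟨b, hb⟩ := exists_eq_two_mul hw
      have h2 : ∑ i, c i ^ 2 = 4 * ∑ i, b i ^ 2 := by
        rw [Finset.mul_sum]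
        exact Finset.sum_congr rfl fun i _ => by rw [hb i]; ring
      have hx4 : ∀ i, x i = 0 ∨ x i = 4 ∨ x i = -4 := by
        intro i
        have h3 : b i ^ 2 ≤ ∑ i, b i ^ 2 :=
          Finset.single_le_sum (f := fun i => b i ^ 2) (fun i _ => sq_nonneg _) (Finset.mem_univ i)
        have h4 : b i ^ 2 ≤ 2 := by omega
        have h5 : b i < 2 := by nlinarith
        have h6 : -2 < b i := by nlinarith
        have h7 : x i = 4 * b i := by rw [h i, hb i]; ring
        omega
      have e := eq_signedVec hx4
      refine ⟨_, _, ?_, ?_, e⟩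
      · rw [e, sum_sq_signedVec] at h32
        omega
      · exact Finset.monotone_filter_right _ fun i _ hi => hi.1
    · right; left
      have h2 := card_le_sum_sq_oddSet c
      have h3 := sum_sq_oddSet_add c
      have h4 : ∀ i ∈ (oddSet c)ᶜ, 0 ≤ c i ^ 2 := fun i _ => sq_nonneg _
      have h5 := card_golaySet hc
      have h6 := Finset.sum_nonneg h4
      -- Now `∑ c i ^ 2 = 8` leaves only weight 8 among the nonzero weights. Equality then holds
      -- throughout: entries are `±1` on the octad and 0 elsewhere.
      have h7 : (oddSet c).card = 8 := by omega
      have h8 := (Finset.sum_eq_zero_iff_of_nonneg h4).1 (by omega)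
      have h9 : ∀ i ∈ oddSet c, c i ^ 2 = 1 := by
        have hge : ∀ i ∈ oddSet c, (1 : ℤ) ≤ c i ^ 2 := by
          intro i hi
          have : c i ≠ 0 := by
            intro h0
            rw [mem_oddSet, h0] at hi
            exact absurd hi (by decide)
          have : 0 < c i ^ 2 := by positivity
          omega
        have heq : ∑ i ∈ oddSet c, (1 : ℤ) = ∑ i ∈ oddSet c, c i ^ 2 := by
          rw [Finset.sum_const, h7]
          norm_num
          omega
        exact fun i hi => ((Finset.sum_eq_sum_iff_of_le hge).1 heq i hi).symm
      have hx0 : ∀ i, x i ≠ 0 ↔ i ∈ oddSet c := by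
        intro i
        by_cases hi : i ∈ oddSet c
        · have := h9 i hi
          simp only [hi, iff_true, h i]
          rintro h0
          rw [show c i = 0 by omega] at this
          norm_num at this
        · have := h8 i (by simpa using hi)
          simp [h i, hi, pow_eq_zero_iff] at this ⊢
          exact this
      have hx2 : ∀ i, x i = 0 ∨ x i = 2 ∨ x i = -2 := by
        intro i
        by_cases hi : i ∈ oddSet c
        · right
          rcases mul_self_eq_one_iff.1 ((sq (c i)).symm.trans (h9 i hi)) with h' | h' <;> have := h i <;>
            omega
        · left
          by_contra h0
          exact hi ((hx0 i).1 h0)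
      have e := eq_signedVec hx2
      have ep : (Finset.univ.filter fun i => x i ≠ 0) = oddSet c := by
        ext i
        simp [← hx0]
      have ht : (Finset.univ.filter fun i => x i ≠ 0 ∧ x i = -2) ⊆ oddSet c := by
        rw [← ep]
        exact Finset.monotone_filter_right _ fun i _ hi => hi.1
      rw [ep] at e
      refine ⟨_, _, hc, h7, ht, ?_, e⟩
      -- The number of minus signs is even because `2 * (8 - 2 |t|)` is twice a multiple of 4.
      have e1 := sum_signedVec 2 ht
      rw [← e] at e1
      have e2 : ∑ i, x i = 2 * ∑ i, c i := by
        rw [Finset.mul_sum]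
        exact Finset.sum_congr rfl fun i _ => h i
      rw [even_iff_two_dvd]
      omega
  · right; right
    have hnn : ∀ i, 0 ≤ c i * (c i + 1) := by
      intro i
      rcases le_or_gt 0 (c i) with h | h
      · positivity
      · exact mul_nonneg_of_nonpos_of_nonpos (by omega) (by omega)
    have h1 : ∑ i, x i ^ 2 = 24 + 4 * ∑ i, c i * (c i + 1) := by
      rw [Finset.mul_sum]
      have : (24 : ℤ) = ∑ i : Fin 24, 1 := by simp
      rw [this, ← Finset.sum_add_distrib]
      refine Finset.sum_congr rfl fun i _ => ?_
      rw [h i]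
      ring
    have h2 : ∑ i, c i * (c i + 1) = 2 := by omega
    obtain ⟨i, hi⟩ : ∃ i, c i * (c i + 1) ≠ 0 := by
      by_contra! hall
      rw [Finset.sum_congr rfl fun i _ => hall i] at h2
      simp at h2
    -- The terms `c j * (c j + 1)` are even and nonnegative with sum 2, so a single one of them is
    -- nonzero.
    have h3 : c i * (c i + 1) = 2 ∧ ∑ j ∈ Finset.univ.erase i, c j * (c j + 1) = 0 := by
      have e := Finset.add_sum_erase Finset.univ (fun j => c j * (c j + 1)) (Finset.mem_univ i)
      have := Int.even_mul_succ_self (c i)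
      rw [even_iff_two_dvd] at this
      have h4 := hnn i
      have h5 : 0 ≤ ∑ j ∈ Finset.univ.erase i, c j * (c j + 1) :=
        Finset.sum_nonneg fun j _ => hnn j
      omega
    have h4 := (Finset.sum_eq_zero_iff_of_nonneg fun j _ => hnn j).1 h3.2
    refine ⟨_, hc, i, funext fun j => ?_⟩
    rw [h j]
    by_cases hj : j = i
    · subst hj
      have h5 : (c j - 1) * (c j + 2) = 0 := by linear_combination h3.1
      rcases mul_eq_zero.1 h5 with h6 | h6
      · rw [show c j = 1 by omega]
        simp [oddVec, mem_oddSet, show c j = 1 by omega]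
      · have : c j = -2 := by omega
        simp [oddVec, mem_oddSet, this]
    · rcases mul_eq_zero.1 (h4 j (Finset.mem_erase.2 ⟨hj, Finset.mem_univ j⟩)) with h6 | h6
      · simp [oddVec, mem_oddSet, hj, h6]
      · have : c j = -1 := by omega
        simp [oddVec, mem_oddSet, hj, this]

theorem signedVec_ne_zero {k : ℤ} (hk : k ≠ 0) {p t : Finset (Fin 24)} {i : Fin 24} :
    signedVec k p t i ≠ 0 ↔ i ∈ p := by
  simp only [signedVec]
  split_ifs <;> simp_all

theorem signedVec_inj {k : ℤ} (hk : k ≠ 0) {p q t u : Finset (Fin 24)} (ht : t ⊆ p) (hu : u ⊆ q)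
    (h : signedVec k p t = signedVec k q u) : p = q ∧ t = u := by
  have hp : p = q := by
    ext i
    rw [← signedVec_ne_zero hk (t := t), h, signedVec_ne_zero hk]
  subst hp
  refine ⟨rfl, ?_⟩
  ext i
  have h1 := congrFun h i
  by_cases hp : i ∈ p
  · simp only [signedVec, hp, if_true] at h1
    by_cases h2 : i ∈ t <;> by_cases h3 : i ∈ u <;> simp only [h2, h3, if_true, if_false] at h1 ⊢ <;>
      omega
  · exact ⟨fun h => absurd (ht h) hp, fun h => absurd (hu h) hp⟩

theorem oddVec_inj {w v : Finset (Fin 24)} {i j : Fin 24} (h : oddVec w i = oddVec v j) :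
    w = v ∧ i = j := by
  have hij : i = j := by
    have := congrFun h i
    simp only [oddVec] at this
    split_ifs at this <;> simp_all
  subst hij
  refine ⟨?_, rfl⟩
  ext l
  have := congrFun h l
  simp only [oddVec] at this
  split_ifs at this <;> simp_all

theorem odd_oddVec (w : Finset (Fin 24)) (i j : Fin 24) : Odd (oddVec w i j) := by
  simp only [oddVec]
  split_ifs <;> decide

theorem even_signedVec {k : ℤ} (hk : Even k) (p t : Finset (Fin 24)) (i : Fin 24) :
    Even (signedVec k p t i) := by
  simp only [signedVec]
  split_ifs
  · exact hk.neg
  · exact hk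
  · exact Even.zero

/-- The pairs of a two-element set of coordinates and a subset. -/
def pairSigns : Finset ((_ : Finset (Fin 24)) × Finset (Fin 24)) :=
  (Finset.powersetCard 2 Finset.univ).sigma Finset.powerset

/-- The pairs of an octad and a subset of even size. -/
def octadSigns : Finset ((_ : Finset (Fin 24)) × Finset (Fin 24)) :=
  (golaySets.filter fun s => s.card = 8).sigma fun p => p.powerset.filter fun t => Even t.card

theorem mem_pairSigns {a : (_ : Finset (Fin 24)) × Finset (Fin 24)} :
    a ∈ pairSigns ↔ a.1.card = 2 ∧ a.2 ⊆ a.1 := by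
  simp [pairSigns]

theorem mem_octadSigns {a : (_ : Finset (Fin 24)) × Finset (Fin 24)} :
    a ∈ octadSigns ↔ (a.1 ∈ golaySets ∧ a.1.card = 8) ∧ a.2 ⊆ a.1 ∧ Even a.2.card := by
  simp [octadSigns]

theorem card_pairSigns : pairSigns.card = 1104 := by
  rw [pairSigns, Finset.card_sigma, Finset.sum_congr rfl (g := fun _ => 4)]
  · simp [Finset.card_powersetCard, Nat.choose]
  · intro p hp
    rw [Finset.card_powerset, (Finset.mem_powersetCard.1 hp).2]
    norm_num

/-- The alternating sum over all subsets of a nonempty set vanishes, so exactly half of the `2 ^ 8`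
subsets are even. -/
theorem card_even_subsets {p : Finset (Fin 24)} (hp : p.card = 8) :
    (p.powerset.filter fun t => Even t.card).card = 128 := by
  have h1 := Finset.sum_powerset_neg_one_pow_card (x := p)
  have hne : p ≠ ∅ := by
    rintro rfl
    simp at hp
  rw [if_neg hne] at h1
  have h2 : ∀ t ∈ p.powerset, (-1 : ℤ) ^ t.card = 2 * (if Even t.card then 1 else 0) - 1 := by
    intro t _
    split_ifs with h
    · rw [h.neg_one_pow]
      norm_num
    · rw [(Nat.not_even_iff_odd.1 h).neg_one_pow]
      norm_num
  rw [Finset.sum_congr rfl h2, Finset.sum_sub_distrib, ← Finset.mul_sum, Finset.sum_boole,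
    Finset.sum_const, Finset.card_powerset, hp] at h1
  norm_num at h1
  omega

theorem card_octadSigns : octadSigns.card = 97152 := by
  rw [octadSigns, Finset.card_sigma, Finset.sum_congr rfl (g := fun _ => 128)]
  · rw [Finset.sum_const, card_octads, smul_eq_mul]
  · exact fun p hp => card_even_subsets (Finset.mem_filter.1 hp).2

/-- The minimal vectors of the Leech lattice, scaled by `√8`. -/
def minimalFinset : Finset (Fin 24 → ℤ) :=
  pairSigns.image (fun a => signedVec 4 a.1 a.2) ∪
    (octadSigns.image (fun a => signedVec 2 a.1 a.2) ∪
      (golaySets ×ˢ Finset.univ).image fun a => oddVec a.1 a.2)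

theorem mem_minimalFinset {x : Fin 24 → ℤ} :
    x ∈ minimalFinset ↔ IntLeech x ∧ ∑ i, x i ^ 2 = 32 := by
  simp only [minimalFinset, Finset.mem_union, Finset.mem_image, mem_pairSigns, mem_octadSigns,
    Finset.mem_product, Finset.mem_univ, and_true]
  constructor
  · rintro (⟨a, ⟨h2, ht⟩, rfl⟩ | ⟨a, ⟨⟨hg, h8⟩, ht, he⟩, rfl⟩ | ⟨a, hw, rfl⟩)
    · exact ⟨intLeech_signedVec_four h2 ht, by rw [sum_sq_signedVec, h2]; norm_num⟩
    · exact ⟨intLeech_signedVec_two hg h8 ht he, by rw [sum_sq_signedVec, h8]; norm_num⟩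
    · exact ⟨intLeech_oddVec hw _, sum_sq_oddVec _ _⟩
  · rintro ⟨hx, h⟩
    rcases minimal_cases hx h with ⟨p, t, h2, ht, rfl⟩ | ⟨p, t, hg, h8, ht, he, rfl⟩ |
      ⟨w, hw, i, rfl⟩
    · exact Or.inl ⟨⟨p, t⟩, ⟨h2, ht⟩, rfl⟩
    · exact Or.inr (Or.inl ⟨⟨p, t⟩, ⟨⟨hg, h8⟩, ht, he⟩, rfl⟩)
    · exact Or.inr (Or.inr ⟨⟨w, i⟩, hw, rfl⟩)

-- The count is `1104 + 759 * 128 + 4096 * 24`. The odd shape is separated from the others by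
-- parity, and the two even shapes by the absolute value of a nonzero entry.
set_option linter.constructorNameAsVariable false in
theorem card_minimalFinset : minimalFinset.card = 196560 := by
  rw [minimalFinset, Finset.card_union_of_disjoint, Finset.card_union_of_disjoint,
    Finset.card_image_of_injOn, Finset.card_image_of_injOn, Finset.card_image_of_injOn,
    card_pairSigns, card_octadSigns, Finset.card_product, card_golaySets]
  · simp
  · rintro ⟨w, i⟩ _ ⟨v, j⟩ _ h
    obtain ⟨rfl, rfl⟩ := oddVec_inj h
    rfl
  · rintro ⟨p, t⟩ hp ⟨q, u⟩ hq h
    rw [Finset.mem_coe, mem_octadSigns] at hp hq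
    obtain ⟨rfl, rfl⟩ := signedVec_inj two_ne_zero hp.2.1 hq.2.1 h
    rfl
  · rintro ⟨p, t⟩ hp ⟨q, u⟩ hq h
    rw [Finset.mem_coe, mem_pairSigns] at hp hq
    obtain ⟨rfl, rfl⟩ := signedVec_inj four_ne_zero hp.2 hq.2 h
    rfl
  · rw [Finset.disjoint_left]
    intro x hx hx'
    simp only [Finset.mem_image] at hx hx'
    obtain ⟨a, -, ha⟩ := hx
    obtain ⟨b, -, hb⟩ := hx'
    rw [← ha] at hb
    have h := odd_oddVec b.1 b.2 0
    rw [hb, ← Int.not_even_iff_odd] at h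
    exact h (even_signedVec even_two _ _ _)
  · rw [Finset.disjoint_left]
    intro x hx hx'
    simp only [Finset.mem_union, Finset.mem_image] at hx hx'
    obtain ⟨a, ha, hax⟩ := hx
    rw [mem_pairSigns] at ha
    obtain ⟨i, hi⟩ : a.1.Nonempty := Finset.card_pos.1 (by omega)
    rcases hx' with ⟨b, -, hb⟩ | ⟨b, -, hb⟩
    · rw [← hax] at hb
      have h := congrFun hb i
      simp only [signedVec, hi] at h
      split_ifs at h <;> simp_all
    · rw [← hax] at hb
      have h := odd_oddVec b.1 b.2 i
      rw [hb, ← Int.not_even_iff_odd] at h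
      exact h (even_signedVec (by decide) _ _ _)

theorem leechMinimalVectors_eq : leechMinimalVectors = toE '' (minimalFinset : Set _) := by
  ext v
  rw [mem_leechMinimalVectors]
  simp only [Set.mem_image, Finset.mem_coe, mem_minimalFinset]

theorem ncard_leechMinimalVectors : leechMinimalVectors.ncard = 196560 := by
  rw [leechMinimalVectors_eq, Set.ncard_image_of_injective _ toE_injective, Set.ncard_coe_finset,
    card_minimalFinset]

theorem finite_leechMinimalVectors : leechMinimalVectors.Finite := by
  rw [leechMinimalVectors_eq]
  exact (Finset.finite_toSet _).image _

theorem toE_mem_leechMinimalVectors {x : Fin 24 → ℤ} :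
    toE x ∈ leechMinimalVectors ↔ x ∈ minimalFinset := by
  rw [leechMinimalVectors_eq, toE_injective.mem_set_image, Finset.mem_coe]

attribute [irreducible] minimalFinset

/-! ### Automorphisms of the Leech lattice -/

/-- Isometries that map the Leech lattice onto itself. -/
def IsLeechAut (g : EuclideanSpace ℝ (Fin 24) ≃ₗᵢ[ℝ] EuclideanSpace ℝ (Fin 24)) : Prop :=
  g '' (leechLattice : Set (EuclideanSpace ℝ (Fin 24))) = leechLattice

theorem IsLeechAut.mem_iff {g : EuclideanSpace ℝ (Fin 24) ≃ₗᵢ[ℝ] EuclideanSpace ℝ (Fin 24)}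
    (hg : IsLeechAut g) {v : EuclideanSpace ℝ (Fin 24)} : g v ∈ leechLattice ↔ v ∈ leechLattice := by
  rw [← SetLike.mem_coe, ← SetLike.mem_coe, ← hg, g.injective.mem_set_image, hg]

theorem isLeechAut_of_mem_iff {g : EuclideanSpace ℝ (Fin 24) ≃ₗᵢ[ℝ] EuclideanSpace ℝ (Fin 24)}
    (h : ∀ v, g v ∈ leechLattice ↔ v ∈ leechLattice) : IsLeechAut g := by
  ext v
  constructor
  · rintro ⟨w, hw, rfl⟩
    exact (h w).2 hw
  · intro hv
    refine ⟨g.symm v, ?_, g.apply_symm_apply v⟩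
    rw [SetLike.mem_coe, ← h, g.apply_symm_apply]
    exact hv

theorem IsLeechAut.refl : IsLeechAut (LinearIsometryEquiv.refl ℝ _) :=
  isLeechAut_of_mem_iff fun _ => Iff.rfl

theorem IsLeechAut.symm {g : EuclideanSpace ℝ (Fin 24) ≃ₗᵢ[ℝ] EuclideanSpace ℝ (Fin 24)}
    (hg : IsLeechAut g) : IsLeechAut g.symm :=
  isLeechAut_of_mem_iff fun v => by rw [← hg.mem_iff, g.apply_symm_apply]

theorem IsLeechAut.trans {g h : EuclideanSpace ℝ (Fin 24) ≃ₗᵢ[ℝ] EuclideanSpace ℝ (Fin 24)}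
    (hg : IsLeechAut g) (hh : IsLeechAut h) : IsLeechAut (g.trans h) :=
  isLeechAut_of_mem_iff fun v => by
    rw [LinearIsometryEquiv.trans_apply, hh.mem_iff, hg.mem_iff]

theorem IsLeechAut.mem_minimal_iff {g : EuclideanSpace ℝ (Fin 24) ≃ₗᵢ[ℝ] EuclideanSpace ℝ (Fin 24)}
    (hg : IsLeechAut g) {v : EuclideanSpace ℝ (Fin 24)} :
    g v ∈ leechMinimalVectors ↔ v ∈ leechMinimalVectors := by
  simp only [leechMinimalVectors, Set.mem_ofPred_eq, hg.mem_iff, g.norm_map]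

/-- Two vectors are conjugate if an automorphism of the Leech lattice maps one to the other. -/
def LeechConj (v w : EuclideanSpace ℝ (Fin 24)) : Prop := ∃ g, IsLeechAut g ∧ g v = w

theorem LeechConj.refl (v : EuclideanSpace ℝ (Fin 24)) : LeechConj v v :=
  ⟨_, IsLeechAut.refl, rfl⟩

theorem LeechConj.symm {v w : EuclideanSpace ℝ (Fin 24)} : LeechConj v w → LeechConj w v := by
  rintro ⟨g, hg, rfl⟩
  exact ⟨g.symm, hg.symm, g.symm_apply_apply v⟩

theorem LeechConj.trans {u v w : EuclideanSpace ℝ (Fin 24)} :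
    LeechConj u v → LeechConj v w → LeechConj u w := by
  rintro ⟨g, hg, rfl⟩ ⟨h, hh, rfl⟩
  exact ⟨g.trans h, hg.trans hh, rfl⟩

/-- An involution that preserves the Leech lattice is an automorphism. -/
theorem isLeechAut_of_involutive
    {g : EuclideanSpace ℝ (Fin 24) ≃ₗᵢ[ℝ] EuclideanSpace ℝ (Fin 24)}
    {f : (Fin 24 → ℤ) → (Fin 24 → ℤ)} (hg : ∀ v, g (g v) = v)
    (hf : ∀ x, IntLeech x → IntLeech (f x)) (h : ∀ x, IntLeech x → g (toE x) = toE (f x)) :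
    IsLeechAut g := by
  have key : ∀ v, v ∈ leechLattice → g v ∈ leechLattice := by
    intro v hv
    obtain ⟨x, hx, rfl⟩ := mem_leechLattice.1 hv
    exact mem_leechLattice.2 ⟨f x, hf x hx, (h x hx).symm⟩
  exact isLeechAut_of_mem_iff fun v => ⟨fun hv => hg v ▸ key _ hv, key v⟩

/-! #### Sign changes -/

/-- The change of the signs of the coordinates in `w`. -/
noncomputable def signChange (w : Finset (Fin 24)) :
    EuclideanSpace ℝ (Fin 24) ≃ₗᵢ[ℝ] EuclideanSpace ℝ (Fin 24) :=
  LinearIsometryEquiv.piLpCongrRight 2 fun i =>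
    if i ∈ w then LinearIsometryEquiv.neg ℝ else LinearIsometryEquiv.refl ℝ ℝ

theorem signChange_apply (w : Finset (Fin 24)) (v : EuclideanSpace ℝ (Fin 24)) (i : Fin 24) :
    signChange w v i = if i ∈ w then -v i else v i := by
  simp only [signChange, LinearIsometryEquiv.piLpCongrRight_apply]
  split_ifs <;> simp

/-- The change of the signs of the coordinates in `w`, for integral vectors. -/
def signInt (w : Finset (Fin 24)) (x : Fin 24 → ℤ) : Fin 24 → ℤ :=
  fun i => if i ∈ w then -x i else x i

/-- Negation on `w` turns `c` into `-m - c` there, which modulo 2 adds `m` times the codeword. The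
coordinate sum drops by `2 |w| m + 4 ∑ i ∈ w, c i`; this is 0 modulo 8 because `4 ∣ |w|` and
codewords meet evenly. -/
theorem IntLeech.signInt {w : Finset (Fin 24)} (hw : w ∈ golaySets) {x : Fin 24 → ℤ}
    (hx : IntLeech x) : IntLeech (signInt w x) := by
  obtain ⟨m, c, h, hc, hs⟩ := hx
  refine ⟨m, fun i => if i ∈ w then -m - c i else c i, fun i => ?_, ?_, ?_⟩
  · simp only [_root_.signInt, h i]
    split_ifs <;> ring
  · convert golayCode.add_mem hc (golayCode.smul_mem (m : ZMod 2) (indWord_mem_golayCode.2 hw))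
      using 1
    ext i
    simp only [indWord, Pi.add_apply, Pi.smul_apply, smul_eq_mul]
    have h2 : ∀ a b : ZMod 2, -a - b = b + a * 1 := by decide
    split_ifs
    · push_cast
      exact h2 _ _
    · simp
  · have h1 : ∑ i, _root_.signInt w x i = ∑ i, x i - 2 * ∑ i ∈ w, x i := by
      rw [← Finset.sum_filter_add_sum_filter_not Finset.univ (· ∈ w) x,
        ← Finset.sum_filter_add_sum_filter_not Finset.univ (· ∈ w) (_root_.signInt w x),
        Finset.filter_univ_mem]
      have e1 : ∑ i ∈ w, _root_.signInt w x i = -∑ i ∈ w, x i := by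
        rw [← Finset.sum_neg_distrib]
        exact Finset.sum_congr rfl fun i hi => by simp [_root_.signInt, hi]
      have e2 : ∑ i with i ∉ w, _root_.signInt w x i = ∑ i with i ∉ w, x i :=
        Finset.sum_congr rfl fun i hi => by
          simp [_root_.signInt, (Finset.mem_filter.1 hi).2]
      rw [e1, e2]
      ring
    have h2 : ∑ i ∈ w, x i = w.card * m + 2 * ∑ i ∈ w, c i := by
      rw [Finset.sum_congr rfl fun i _ => h i, Finset.sum_add_distrib, Finset.mul_sum]
      simp
    have h3 := sum_odd_mod (c := c) (s := w)
    have h4 := even_card_inter hw (cast_mem_golayCode.1 hc)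
    obtain ⟨k, hk⟩ := four_dvd_card_golaySet hw
    have h5 : (w.card : ℤ) * m = 4 * (k * m) := by rw [hk]; push_cast; ring
    rw [even_iff_two_dvd] at h4
    rw [h1, h2, h5]
    rw [Int.ModEq] at hs ⊢
    omega

theorem signChange_toE (w : Finset (Fin 24)) (x : Fin 24 → ℤ) :
    signChange w (toE x) = toE (signInt w x) := by
  ext i
  rw [signChange_apply, toE_apply, toE_apply, signInt]
  split_ifs
  · push_cast
    ring
  · rfl

theorem isLeechAut_signChange {w : Finset (Fin 24)} (hw : w ∈ golaySets) :
    IsLeechAut (signChange w) := by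
  refine isLeechAut_of_involutive (f := signInt w) (fun v => ?_) (fun x hx => hx.signInt hw)
    fun x _ => signChange_toE w x
  ext i
  simp only [signChange_apply]
  split_ifs <;> simp

theorem signInt_oddVec (w : Finset (Fin 24)) (i : Fin 24) :
    signInt w (oddVec w i) = oddVec ∅ i := by
  ext j
  simp only [signInt, oddVec, Finset.notMem_empty, if_false]
  split_ifs <;> norm_num

theorem leechConj_oddVec {w : Finset (Fin 24)} (hw : w ∈ golaySets) (i : Fin 24) :
    LeechConj (toE (oddVec w i)) (toE (oddVec ∅ i)) :=
  ⟨_, isLeechAut_signChange hw, by rw [signChange_toE, signInt_oddVec]⟩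

/-! #### The automorphisms given by sextets -/

/-- The coordinates with a given label. -/
def tetrad (τ : Fin 24 → Fin 6) (a : Fin 6) : Finset (Fin 24) :=
  Finset.univ.filter fun i => τ i = a

/-- A partition of the coordinates into six sets of size four, any two of which form a codeword. -/
def IsSextet (τ : Fin 24 → Fin 6) : Prop :=
  (∀ a, (tetrad τ a).card = 4) ∧ ∀ a b, a ≠ b → tetrad τ a ∪ tetrad τ b ∈ golaySets

/-- The sign of a tetrad: the first one is negated. -/
def tetradSign (a : Fin 6) : ℤ := if a = 0 then -1 else 1

theorem tetradSign_mul_self (a : Fin 6) : tetradSign a * tetradSign a = 1 := by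
  revert a
  decide

theorem sum_sum_tetrad {R : Type*} [AddCommMonoid R] (τ : Fin 24 → Fin 6) (f : Fin 24 → R) :
    ∑ a, ∑ i ∈ tetrad τ a, f i = ∑ i, f i :=
  Finset.sum_fiberwise _ _ _

/-- Half of the sum over its tetrad is subtracted from each coordinate, and the first tetrad is
negated. -/
noncomputable def sextetLin (τ : Fin 24 → Fin 6) :
    EuclideanSpace ℝ (Fin 24) →ₗ[ℝ] EuclideanSpace ℝ (Fin 24) where
  toFun v := WithLp.toLp 2 fun i =>
    (tetradSign (τ i) : ℝ) * (v i - (∑ j ∈ tetrad τ (τ i), v j) / 2)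
  map_add' v w := by
    ext i
    simp only [PiLp.add_apply, Finset.sum_add_distrib]
    ring
  map_smul' r v := by
    ext i
    simp only [PiLp.smul_apply, smul_eq_mul, ← Finset.mul_sum, RingHom.id_apply]
    ring

theorem sextetLin_apply (τ : Fin 24 → Fin 6) (v : EuclideanSpace ℝ (Fin 24)) (i : Fin 24) :
    sextetLin τ v i = (tetradSign (τ i) : ℝ) * (v i - (∑ j ∈ tetrad τ (τ i), v j) / 2) := rfl

/-- Subtracting half the sum from four coordinates reverses the sum. Up to sign the map is, on each
tetrad, the reflection in `(1, 1, 1, 1)`, and so it is an involution and an isometry. -/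
theorem sum_tetrad_sextetLin {τ : Fin 24 → Fin 6} (hτ : IsSextet τ)
    (v : EuclideanSpace ℝ (Fin 24)) (a : Fin 6) :
    ∑ i ∈ tetrad τ a, sextetLin τ v i = -(tetradSign a : ℝ) * ∑ i ∈ tetrad τ a, v i := by
  have h : ∀ i ∈ tetrad τ a, sextetLin τ v i =
      (tetradSign a : ℝ) * (v i - (∑ j ∈ tetrad τ a, v j) / 2) := by
    intro i hi
    rw [sextetLin_apply, (Finset.mem_filter.1 hi).2]
  rw [Finset.sum_congr rfl h, ← Finset.mul_sum, Finset.sum_sub_distrib, Finset.sum_const, hτ.1 a]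
  simp only [nsmul_eq_mul]
  push_cast
  ring

theorem sextetLin_sextetLin {τ : Fin 24 → Fin 6} (hτ : IsSextet τ)
    (v : EuclideanSpace ℝ (Fin 24)) : sextetLin τ (sextetLin τ v) = v := by
  ext i
  rw [sextetLin_apply, sum_tetrad_sextetLin hτ, sextetLin_apply]
  have h : (tetradSign (τ i) : ℝ) * tetradSign (τ i) = 1 := by
    exact_mod_cast tetradSign_mul_self (τ i)
  linear_combination v i * h

theorem norm_sextetLin {τ : Fin 24 → Fin 6} (hτ : IsSextet τ) (v : EuclideanSpace ℝ (Fin 24)) :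
    ‖sextetLin τ v‖ = ‖v‖ := by
  rw [← sq_eq_sq₀ (norm_nonneg _) (norm_nonneg _), EuclideanSpace.real_norm_sq_eq,
    EuclideanSpace.real_norm_sq_eq, ← sum_sum_tetrad τ, ← sum_sum_tetrad τ fun i => v i ^ 2]
  refine Finset.sum_congr rfl fun a _ => ?_
  set σ := ∑ j ∈ tetrad τ a, v j with hσ
  have h : ∀ i ∈ tetrad τ a, sextetLin τ v i ^ 2 = v i ^ 2 - v i * σ + σ ^ 2 / 4 := by
    intro i hi
    have h1 : (tetradSign a : ℝ) * tetradSign a = 1 := by exact_mod_cast tetradSign_mul_self a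
    rw [sextetLin_apply, (Finset.mem_filter.1 hi).2, ← hσ]
    linear_combination (v i - σ / 2) ^ 2 * h1
  rw [Finset.sum_congr rfl h, Finset.sum_add_distrib, Finset.sum_sub_distrib, ← Finset.sum_mul,
    ← hσ, Finset.sum_const, hτ.1 a]
  simp only [nsmul_eq_mul]
  push_cast
  ring

/-- `sextetLin` as an isometry. -/
noncomputable def sextetIso {τ : Fin 24 → Fin 6} (hτ : IsSextet τ) :
    EuclideanSpace ℝ (Fin 24) ≃ₗᵢ[ℝ] EuclideanSpace ℝ (Fin 24) where
  toLinearEquiv := LinearEquiv.ofInvolutive (sextetLin τ) (sextetLin_sextetLin hτ)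
  norm_map' := norm_sextetLin hτ

theorem sextetIso_apply {τ : Fin 24 → Fin 6} (hτ : IsSextet τ) (v : EuclideanSpace ℝ (Fin 24)) :
    sextetIso hτ v = sextetLin τ v := rfl

/-- The operation of `sextetLin` on integral vectors. -/
def sextetInt (τ : Fin 24 → Fin 6) (x : Fin 24 → ℤ) : Fin 24 → ℤ :=
  fun i => tetradSign (τ i) * (x i - (∑ j ∈ tetrad τ (τ i), x j) / 2)

/-- Tetrad sums of lattice vectors are even, which makes the integer division in `sextetInt` exact.
-/
theorem sum_tetrad_add {τ : Fin 24 → Fin 6} (hτ : IsSextet τ) {x c : Fin 24 → ℤ} {m : ℤ}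
    (h : ∀ i, x i = m + 2 * c i) (a : Fin 6) :
    ∑ i ∈ tetrad τ a, x i = 2 * (2 * m + ∑ i ∈ tetrad τ a, c i) := by
  rw [Finset.sum_congr rfl fun i _ => h i, Finset.sum_add_distrib, Finset.sum_const, hτ.1 a,
    ← Finset.mul_sum]
  simp only [nsmul_eq_mul]
  push_cast
  ring

theorem sextetIso_toE {τ : Fin 24 → Fin 6} (hτ : IsSextet τ) {x : Fin 24 → ℤ} (hx : IntLeech x) :
    sextetIso hτ (toE x) = toE (sextetInt τ x) := by
  obtain ⟨m, c, h, -, -⟩ := hx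
  ext i
  rw [sextetIso_apply, sextetLin_apply, toE_apply (sextetInt τ x), sextetInt]
  simp only [toE_apply]
  rw [← Finset.sum_div, ← Int.cast_sum, sum_tetrad_add hτ h,
    Int.mul_ediv_cancel_left _ (by norm_num)]
  push_cast
  ring

/-- The image has the form `M + 2 * d`, where `d` differs from `c` modulo 2 by a sum of codewords,
each the union of the first tetrad with another one. The negation of the first tetrad supplies the
part of this sum on that tetrad. -/
theorem IntLeech.sextetInt {τ : Fin 24 → Fin 6} (hτ : IsSextet τ) {x : Fin 24 → ℤ}
    (hx : IntLeech x) : IntLeech (sextetInt τ x) := by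
  obtain ⟨m, c, h, hc, hs⟩ := hx
  set σ : Fin 6 → ℤ := fun a => ∑ i ∈ tetrad τ a, c i with hσ
  -- Two tetrads form a codeword, which meets the word of `c` evenly; so all tetrad sums of `c` have
  -- the same parity.
  have hpar : ∀ a, ∃ t, σ a = σ 0 + 2 * t := by
    intro a
    by_cases ha : a = 0
    · exact ⟨0, by rw [ha]; ring⟩
    · have h1 := hτ.2 a 0 ha
      have h2 := even_card_inter h1 (cast_mem_golayCode.1 hc)
      have h3 := sum_odd_mod (c := c) (s := tetrad τ a ∪ tetrad τ 0)
      have hd : Disjoint (tetrad τ a) (tetrad τ 0) := by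
        rw [Finset.disjoint_left]
        intro i hi hi'
        exact ha ((Finset.mem_filter.1 hi).2.symm.trans (Finset.mem_filter.1 hi').2)
      rw [Finset.sum_union hd] at h3
      rw [even_iff_two_dvd] at h2
      refine ⟨(σ a - σ 0) / 2, ?_⟩
      simp only [hσ]
      omega
  choose t ht using hpar
  have ht0 : t 0 = 0 := by
    have := ht 0
    omega
  have hsum : ∑ i, c i = 6 * σ 0 + 2 * ∑ a, t a := by
    rw [← sum_sum_tetrad τ c, Finset.sum_congr rfl fun a _ => ht a, Finset.sum_add_distrib,
      ← Finset.mul_sum, Finset.sum_const]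
    simp only [Finset.card_univ, Fintype.card_fin, nsmul_eq_mul]
    push_cast
    rfl
  have hx : ∑ i, x i = 24 * m + 2 * ∑ i, c i := by
    rw [Finset.sum_congr rfl fun i _ => h i, Finset.sum_add_distrib, Finset.mul_sum]
    simp
  have hval : ∀ i, _root_.sextetInt τ x i = tetradSign (τ i) * (2 * c i - m - σ (τ i)) := by
    intro i
    rw [_root_.sextetInt, sum_tetrad_add hτ h, Int.mul_ediv_cancel_left _ (by norm_num), h i]
    simp only [hσ]
    ring
  set M := -m - σ 0 with hM
  set d : Fin 24 → ℤ := fun i => if τ i = 0 then -M - c i else c i - t (τ i) with hd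
  have hword : (fun i => (d i : ZMod 2)) = (fun i => (c i : ZMod 2)) +
      ∑ a ∈ Finset.univ.erase (0 : Fin 6),
        (t a : ZMod 2) • indWord (tetrad τ a ∪ tetrad τ 0) := by
    -- The condition on the coordinate sum modulo 8 says that `m + σ 0 + ∑ t a` is even, and `t 0 =
    -- 0`.
    have hMt : ((M : ℤ) : ZMod 2) = ∑ a ∈ Finset.univ.erase (0 : Fin 6), (t a : ZMod 2) := by
      rw [← Int.cast_sum, ZMod.intCast_eq_intCast_iff]
      have e := Finset.add_sum_erase Finset.univ t (Finset.mem_univ 0)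
      rw [hx, hsum] at hs
      rw [Int.ModEq] at hs ⊢
      push_cast
      omega
    ext i
    simp only [Pi.add_apply, Finset.sum_apply, Pi.smul_apply, smul_eq_mul, indWord,
      Finset.mem_union, tetrad, Finset.mem_filter, Finset.mem_univ, true_and]
    by_cases hi : τ i = 0
    · simp only [hd, hi, if_true, or_true, mul_one, ← hMt]
      push_cast
      have h2 : ∀ a b : ZMod 2, -a - b = b + a := by decide
      exact h2 _ _
    · have h2 : ∀ a b : ZMod 2, a - b = a + b := by decide
      simp only [hd, hi, if_false, or_false]
      push_cast
      rw [h2, Finset.sum_eq_single (τ i)]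
      · simp
      · intro b _ hb
        rw [if_neg (Ne.symm hb), mul_zero]
      · intro hb
        exact absurd (Finset.mem_erase.2 ⟨hi, Finset.mem_univ _⟩) hb
  have hxd : ∀ i, _root_.sextetInt τ x i = M + 2 * d i := by
    intro i
    rw [hval i]
    by_cases hi : τ i = 0
    · simp only [hd, hi, tetradSign, if_true, hM]
      ring
    · simp only [hd, hi, tetradSign, if_false, hM, ht (τ i)]
      ring
  refine ⟨M, d, hxd, ?_, ?_⟩
  · rw [hword]
    exact golayCode.add_mem hc (Submodule.sum_mem _ fun a ha => golayCode.smul_mem _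
      (indWord_mem_golayCode.2 (hτ.2 a 0 (Finset.ne_of_mem_erase ha))))
  · have e1 : ∀ a, ∑ i ∈ tetrad τ a, d i = if a = 0 then -4 * M - σ 0 else σ a - 4 * t a := by
      intro a
      have : ∀ i ∈ tetrad τ a, d i = if a = 0 then -M - c i else c i - t a := by
        intro i hi
        simp only [hd, (Finset.mem_filter.1 hi).2]
      rw [Finset.sum_congr rfl this]
      split_ifs with ha
      · subst ha
        rw [Finset.sum_sub_distrib, Finset.sum_const, hτ.1]
        simp [hσ]
      · rw [Finset.sum_sub_distrib, Finset.sum_const, hτ.1]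
        simp [hσ]
    have e2 : ∑ i, d i = -4 * M - 2 * σ 0 + ∑ i, c i - 4 * ∑ a, t a := by
      have e3 : ∀ a, ∑ i ∈ tetrad τ a, d i =
          (σ a - 4 * t a) + if a = 0 then -4 * M - 2 * σ 0 else 0 := by
        intro a
        rw [e1]
        split_ifs with ha
        · rw [ha, ht0]
          ring
        · ring
      rw [← sum_sum_tetrad τ d, Finset.sum_congr rfl fun a _ => e3 a, Finset.sum_add_distrib,
        Finset.sum_sub_distrib, ← Finset.mul_sum, ← sum_sum_tetrad τ c]
      simp
      ring
    have e4 : ∑ i, _root_.sextetInt τ x i = 24 * M + 2 * ∑ i, d i := by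
      rw [Finset.sum_congr rfl fun i _ => hxd i, Finset.sum_add_distrib, Finset.mul_sum]
      simp
    rw [e4, e2]
    rw [hx] at hs
    rw [Int.ModEq] at hs ⊢
    omega

theorem isLeechAut_sextetIso {τ : Fin 24 → Fin 6} (hτ : IsSextet τ) :
    IsLeechAut (sextetIso hτ) :=
  isLeechAut_of_involutive (sextetLin_sextetLin hτ) (fun _ hx => hx.sextetInt hτ)
    fun _ hx => sextetIso_toE hτ hx

theorem leechConj_sextetInt {τ : Fin 24 → Fin 6} (hτ : IsSextet τ) {x : Fin 24 → ℤ}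
    (hx : x ∈ minimalFinset) :
    sextetInt τ x ∈ minimalFinset ∧ LeechConj (toE x) (toE (sextetInt τ x)) := by
  have h1 := mem_minimalFinset.1 hx
  have h2 := sextetIso_toE hτ h1.1
  refine ⟨?_, _, isLeechAut_sextetIso hτ, h2⟩
  rw [← toE_mem_leechMinimalVectors, ← h2, (isLeechAut_sextetIso hτ).mem_minimal_iff,
    toE_mem_leechMinimalVectors]
  exact hx

/-! ### Transitivity on the minimal vectors -/

/-- Eight sextets; the hexadecimal digit number `i` is the label of the coordinate `i`. -/
def sextetCode : Fin 8 → ℕ :=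
  ![0x505434521302040121233451, 0x054334200230151154352412, 0x540430502413325021315421,
    0x543504023020251453314121, 0x005543213544001423251231, 0x544000324210145512331532,
    0x545534203310204024112315, 0x543340025410151033514222]

/-- The labelling of the coordinates by the tetrads of a sextet. -/
def sextet (s : Fin 8) (i : Fin 24) : Fin 6 := Fin.ofNat 6 (sextetCode s / 16 ^ i.val % 16)

/-- The union of two tetrads as a bit mask. -/
def tetradMask (s : Fin 8) (a b : Fin 6) : ℕ :=
  ∑ i : Fin 24, if sextet s i = a ∨ sextet s i = b then 2 ^ i.val else 0

theorem bits_tetradMask : ∀ s a b i, (tetradMask s a b).testBit (i : Fin 24).val = true ↔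
    sextet s i = a ∨ sextet s i = b := by
  decide +kernel

theorem golayWord_tetradMask : ∀ s a b, a ≠ b →
    golayWord (golayDecode (tetradMask s a b)) = tetradMask s a b := by
  decide +kernel

theorem card_tetrad_sextet : ∀ s a, (tetrad (sextet s) a).card = 4 := by
  decide +kernel

/-- The table pairs each of the eight sextets with the mask of its first tetrad, as
`tetradMask_zero` confirms. An odd intersection is what makes a sextet map turn a vector supported
on the octad into an odd one. -/
theorem exists_odd_popCount : ∀ m < 4096, popCount 24 (golayWord m) = 8 →
    ∃ n ∈ [(0, 0x402a00), (1, 0x819000), (2, 0x250100), (3, 0xa5000), (4, 0xc00c00),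
      ((5 : Fin 8), 0x1c1000), (6, 0x11500), (7, 0x61100)],
      popCount 24 (golayWord m &&& n.2) % 2 = 1 :=
  forall_lt_4096 (by decide +kernel)

theorem tetradMask_zero : ∀ n ∈ [(0, 0x402a00), (1, 0x819000), (2, 0x250100), (3, 0xa5000),
    (4, 0xc00c00), ((5 : Fin 8), 0x1c1000), (6, 0x11500), (7, 0x61100)],
    tetradMask n.1 0 0 = n.2 := by
  decide +kernel

theorem exists_sextet_separating : ∀ i j : Fin 24, i ≠ j → ∃ s, sextet s i ≠ sextet s j := by
  decide +kernel

/-- For each coordinate `i ≠ 0` a smaller coordinate `j`, a sextet with `i` and `j` in one tetrad,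
and the message of a codeword that meets this tetrad in `i` and `j`. -/
def joinTable : Fin 24 → Fin 24 × Fin 8 × ℕ :=
  ![(0, 0, 0), (0, 7, 1), (1, 7, 2), (0, 1, 5), (0, 3, 9), (1, 5, 1), (0, 0, 1), (1, 2, 1), (1, 1, 2), (0, 3, 1), (2, 0, 2), (1, 3, 1), (7, 0, 2), (8, 4, 4), (3, 1, 8), (5, 3, 16), (11, 3, 32), (7, 4, 64), (8, 3, 128), (13, 1, 256), (14, 2, 512), (15, 3, 1024), (11, 0, 2048), (0, 6, 1)]

theorem joinTable_spec : ∀ i : Fin 24, i ≠ 0 →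
    (joinTable i).1 < i ∧ (joinTable i).2.2 < 4096 ∧
      sextet (joinTable i).2.1 i = sextet (joinTable i).2.1 (joinTable i).1 ∧
      golayWord (joinTable i).2.2 &&& tetradMask (joinTable i).2.1
        (sextet (joinTable i).2.1 i) (sextet (joinTable i).2.1 i) =
          2 ^ i.val + 2 ^ (joinTable i).1.val := by
  decide +kernel

theorem mem_golaySets_of_golayDecode {n : ℕ} (h : golayWord (golayDecode n) = n) :
    bits n ∈ golaySets :=
  Finset.mem_image.2 ⟨golayDecode n, Finset.mem_range.2 (Nat.mod_lt _ (by norm_num)), by rw [h]⟩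

theorem bits_golayWord_mem {m : ℕ} (hm : m < 4096) : bits (golayWord m) ∈ golaySets :=
  Finset.mem_image.2 ⟨m, Finset.mem_range.2 hm, rfl⟩

theorem bits_tetradMask_eq (s : Fin 8) (a b : Fin 6) :
    bits (tetradMask s a b) = tetrad (sextet s) a ∪ tetrad (sextet s) b := by
  ext i
  rw [mem_bits, bits_tetradMask]
  simp [tetrad]

theorem bits_land (a b : ℕ) : bits (a &&& b) = bits a ∩ bits b := by
  ext i
  simp [mem_bits, Nat.testBit_and]

theorem isSextet_sextet (s : Fin 8) : IsSextet (sextet s) :=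
  ⟨card_tetrad_sextet s, fun a b hab => by
    rw [← bits_tetradMask_eq]
    exact mem_golaySets_of_golayDecode (golayWord_tetradMask s a b hab)⟩

theorem exists_odd_tetrad {p : Finset (Fin 24)} (hp : p ∈ golaySets) (h8 : p.card = 8) :
    ∃ s, (p ∩ tetrad (sextet s) 0).card % 2 = 1 := by
  obtain ⟨m, hm, rfl⟩ := Finset.mem_image.1 hp
  rw [card_bits] at h8
  obtain ⟨n, hn, h⟩ := exists_odd_popCount m (Finset.mem_range.1 hm) h8
  refine ⟨n.1, ?_⟩
  have e := bits_tetradMask_eq n.1 0 0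
  rw [Finset.union_self, tetradMask_zero n hn] at e
  rw [← e, ← bits_land, card_bits, h]

theorem exists_golaySet_inter {i : Fin 24} (hi : i ≠ 0) : ∃ j < i, ∃ s, ∃ w ∈ golaySets,
    sextet s i = sextet s j ∧ w ∩ tetrad (sextet s) (sextet s i) = {i, j} := by
  have key : ∀ i j : Fin 24, j < i → bits (2 ^ i.val + 2 ^ j.val) = {i, j} := by decide +kernel
  obtain ⟨h1, h2, h3, h4⟩ := joinTable_spec i hi
  refine ⟨_, h1, _, _, bits_golayWord_mem h2, h3, ?_⟩
  have e := bits_tetradMask_eq (joinTable i).2.1 (sextet (joinTable i).2.1 i)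
    (sextet (joinTable i).2.1 i)
  rw [Finset.union_self] at e
  rw [← e, ← bits_land, h4, key _ _ h1]

/-! ### Conjugacy of the shapes of minimal vectors -/

theorem oddVec_mem_minimalFinset {w : Finset (Fin 24)} (hw : w ∈ golaySets) (i : Fin 24) :
    oddVec w i ∈ minimalFinset :=
  mem_minimalFinset.2 ⟨intLeech_oddVec hw i, sum_sq_oddVec w i⟩

/-- After the sign change on `w`, the tetrad of `i` and `j` carries `3` at `i`, `-1` at `j` and `1`
twice. Its sum is 4, so the sextet map gives `1, -3, -1, -1` up to a common sign: the large entry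
has moved from `i` to `j`. An entry `±3` occurs only in the odd shape, and only at its special
coordinate. -/
theorem leechConj_oddVec_of_joined {i j : Fin 24} (hij : i ≠ j) {s : Fin 8}
    {w : Finset (Fin 24)} (hw : w ∈ golaySets) (h : sextet s i = sextet s j)
    (hT : w ∩ tetrad (sextet s) (sextet s i) = {i, j}) :
    LeechConj (toE (oddVec ∅ i)) (toE (oddVec ∅ j)) := by
  set T := tetrad (sextet s) (sextet s i) with hTdef
  have hmem : ∀ l, l ∈ T → (l ∈ w ↔ l = i ∨ l = j) := by
    intro l hl
    simpa [hl] using Finset.ext_iff.1 hT l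
  have hiT : i ∈ T := by simp [hTdef, tetrad]
  have hjT : j ∈ T := by simp [hTdef, tetrad, h]
  obtain ⟨hmin, hconj⟩ := leechConj_sextetInt (isSextet_sextet s) (oddVec_mem_minimalFinset hw i)
  have hval : ∀ l ∈ T, oddVec w i l = 1 + (if l = i then 2 else 0) - if l = j then 2 else 0 := by
    intro l hl
    have := hmem l hl
    by_cases h1 : l = i
    · subst h1
      simp [oddVec, this, hij]
    · by_cases h2 : l = j
      · subst h2
        simp [oddVec, this, h1]
      · simp [oddVec, this, h1, h2]
  have hsum : ∑ l ∈ T, oddVec w i l = 4 := by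
    rw [Finset.sum_congr rfl hval, Finset.sum_sub_distrib, Finset.sum_add_distrib,
      Finset.sum_ite_eq', Finset.sum_ite_eq', if_pos hiT, if_pos hjT, Finset.sum_const,
      (isSextet_sextet s).1]
    norm_num
  have hj : sextetInt (sextet s) (oddVec w i) j = tetradSign (sextet s j) * -3 := by
    rw [sextetInt, ← h, ← hTdef, hsum, hval j hjT]
    simp [Ne.symm hij]
  have hj3 : sextetInt (sextet s) (oddVec w i) j = 3 ∨
      sextetInt (sextet s) (oddVec w i) j = -3 := by
    rw [hj, tetradSign]
    split_ifs <;> simp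
  have h1 := mem_minimalFinset.1 hmin
  rcases minimal_cases h1.1 h1.2 with ⟨p, t, -, -, e⟩ | ⟨p, t, -, -, -, -, e⟩ | ⟨v, hv, k, e⟩
  · rw [e] at hj3
    simp only [signedVec] at hj3
    split_ifs at hj3 <;> norm_num at hj3
  · rw [e] at hj3
    simp only [signedVec] at hj3
    split_ifs at hj3 <;> norm_num at hj3
  · rw [e] at hj3 hconj
    have hk : k = j := by
      by_contra hk
      simp only [oddVec, Ne.symm hk, if_false] at hj3
      split_ifs at hj3 <;> omega
    subst hk
    exact ((leechConj_oddVec hw i).symm.trans hconj).trans (leechConj_oddVec hv k)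

theorem leechConj_oddVec_zero (i : Fin 24) : LeechConj (toE (oddVec ∅ i)) (toE (oddVec ∅ 0)) := by
  induction i using WellFoundedLT.induction with
  | ind i ih =>
    by_cases hi : i = 0
    · rw [hi]
      exact LeechConj.refl _
    · obtain ⟨j, hj, s, w, hw, h, hT⟩ := exists_golaySet_inter hi
      exact (leechConj_oddVec_of_joined hj.ne' hw h hT).trans (ih j hj)

/-- For a sextet whose first tetrad meets the octad oddly, half of the tetrad sum is odd. The image
therefore has an odd entry and must be of odd shape. -/
theorem leechConj_octad {p t : Finset (Fin 24)} (hp : p ∈ golaySets) (h8 : p.card = 8)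
    (ht : t ⊆ p) (he : Even t.card) :
    LeechConj (toE (signedVec 2 p t)) (toE (oddVec ∅ 0)) := by
  obtain ⟨s, hs⟩ := exists_odd_tetrad hp h8
  have hmem : signedVec 2 p t ∈ minimalFinset :=
    mem_minimalFinset.2 ⟨intLeech_signedVec_two hp h8 ht he, by
      rw [sum_sq_signedVec, h8]
      norm_num⟩
  obtain ⟨hmin, hconj⟩ := leechConj_sextetInt (isSextet_sextet s) hmem
  obtain ⟨i, hi⟩ : (tetrad (sextet s) 0).Nonempty :=
    Finset.card_pos.1 (by rw [card_tetrad_sextet]; norm_num)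
  have hi0 : sextet s i = 0 := (Finset.mem_filter.1 hi).2
  have h2 : ∀ j, signedVec 2 p t j = 2 * signedVec 1 p t j := by
    intro j
    simp only [signedVec]
    split_ifs <;> rfl
  have hodd : oddSet (signedVec 1 p t) = p := by
    ext j
    simp only [mem_oddSet, signedVec]
    split_ifs with h1 h2 <;> simp [h1]
  have hsum := sum_odd_mod (c := signedVec 1 p t) (s := tetrad (sextet s) 0)
  rw [hodd, Finset.inter_comm] at hsum
  have hval : sextetInt (sextet s) (signedVec 2 p t) i =
      -(2 * signedVec 1 p t i - ∑ j ∈ tetrad (sextet s) 0, signedVec 1 p t j) := by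
    rw [sextetInt, hi0, Finset.sum_congr rfl fun j _ => h2 j, ← Finset.mul_sum,
      Int.mul_ediv_cancel_left _ (by norm_num), h2 i]
    simp [tetradSign]
  have hoddi : sextetInt (sextet s) (signedVec 2 p t) i % 2 = 1 := by
    rw [hval]
    omega
  have h1 := mem_minimalFinset.1 hmin
  rcases minimal_cases h1.1 h1.2 with ⟨q, u, -, -, e⟩ | ⟨q, u, -, -, -, -, e⟩ | ⟨v, hv, k, e⟩
  · rw [e] at hoddi
    have := even_signedVec (k := 4) (by decide) q u i
    rw [Int.even_iff] at this
    omega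
  · rw [e] at hoddi
    have := even_signedVec (k := 2) (by decide) q u i
    rw [Int.even_iff] at this
    omega
  · rw [e] at hconj
    exact (hconj.trans (leechConj_oddVec hv k)).trans (leechConj_oddVec_zero k)

/-- If a sextet separates the two coordinates, the tetrad of `i` has sum `±4` and the entry at `i`
becomes `±2`. Thus the image is not of shape `(±4)², 0²²`, and the shapes already treated remain. -/
theorem leechConj_pair {p t : Finset (Fin 24)} (h2 : p.card = 2) (ht : t ⊆ p) :
    LeechConj (toE (signedVec 4 p t)) (toE (oddVec ∅ 0)) := by
  have hmem : signedVec 4 p t ∈ minimalFinset :=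
    mem_minimalFinset.2 ⟨intLeech_signedVec_four h2 ht, by
      rw [sum_sq_signedVec, h2]
      norm_num⟩
  obtain ⟨i, j, hij, rfl⟩ := Finset.card_eq_two.1 h2
  obtain ⟨s, hs⟩ := exists_sextet_separating i j hij
  obtain ⟨hmin, hconj⟩ := leechConj_sextetInt (isSextet_sextet s) hmem
  have hsum : ∑ l ∈ tetrad (sextet s) (sextet s i), signedVec 4 {i, j} t l =
      signedVec 4 {i, j} t i := by
    refine Finset.sum_eq_single i (fun l hl hli => ?_) fun h => absurd ?_ h
    · have hlj : l ≠ j := by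
        rintro rfl
        exact hs (Finset.mem_filter.1 hl).2.symm
      simp [signedVec, hli, hlj]
    · simp [tetrad]
  have hval : sextetInt (sextet s) (signedVec 4 {i, j} t) i = 2 ∨
      sextetInt (sextet s) (signedVec 4 {i, j} t) i = -2 := by
    rw [sextetInt, hsum]
    simp only [signedVec, Finset.mem_insert, true_or, if_true, tetradSign]
    split_ifs <;> norm_num
  have h1 := mem_minimalFinset.1 hmin
  rcases minimal_cases h1.1 h1.2 with ⟨q, u, -, -, e⟩ | ⟨q, u, hq, h8, hu, he, e⟩ | ⟨v, hv, k, e⟩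
  · rw [e] at hval
    simp only [signedVec] at hval
    split_ifs at hval <;> norm_num at hval
  · rw [e] at hconj
    exact hconj.trans (leechConj_octad hq h8 hu he)
  · rw [e] at hconj
    exact (hconj.trans (leechConj_oddVec hv k)).trans (leechConj_oddVec_zero k)

/-- The automorphisms of the Leech lattice act transitively on its minimal vectors. -/
theorem leechConj_of_minimal {v w : EuclideanSpace ℝ (Fin 24)} (hv : v ∈ leechMinimalVectors)
    (hw : w ∈ leechMinimalVectors) : LeechConj v w := by
  have key : ∀ v ∈ leechMinimalVectors, LeechConj v (toE (oddVec ∅ 0)) := by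
    intro v hv
    obtain ⟨x, hx, rfl⟩ := mem_leechMinimalVectors.1 hv
    rcases minimal_cases hx.1 hx.2 with ⟨p, t, h2, ht, rfl⟩ | ⟨p, t, hp, h8, ht, he, rfl⟩ |
      ⟨w, hw, i, rfl⟩
    · exact leechConj_pair h2 ht
    · exact leechConj_octad hp h8 ht he
    · exact (leechConj_oddVec hw i).trans (leechConj_oddVec_zero i)
  exact (key v hv).trans (key w hw).symm

/-! ### Averaging over the automorphism group -/

/-- In a transitive action of a finite group, some translate of `s` meets `u` in at most the average
number of points. -/
theorem exists_smul_inter_card_mul_le {G X : Type*} [Group G] [Fintype G] [Fintype X]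
    [DecidableEq X] [MulAction G X] [MulAction.IsPretransitive G X] (s u : Finset X) :
    ∃ g : G, (s.filter fun x => g • x ∈ u).card * Fintype.card X ≤ s.card * u.card := by
  classical
  -- Left multiplication shows that the number of `g` with `g • x = y` does not depend on `y`, so it
  -- is `|G| / |X|`. Double counting then gives the exact mean of the intersection sizes.
  let N : X → X → ℕ := fun x y => (Finset.univ.filter fun g : G => g • x = y).card
  have hconst : ∀ x y z, N x y = N x z := by
    intro x y z
    obtain ⟨h, hh⟩ := MulAction.exists_smul_eq G y z
    refine Finset.card_bij (fun g _ => h * g) (fun g hg => ?_) (fun g _ g' _ e => mul_left_cancel e)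
      fun g hg => ⟨h⁻¹ * g, ?_, by simp⟩
    · rw [Finset.mem_filter] at hg ⊢
      exact ⟨Finset.mem_univ _, by rw [mul_smul, hg.2, hh]⟩
    · rw [Finset.mem_filter] at hg ⊢
      exact ⟨Finset.mem_univ _, by rw [mul_smul, hg.2, ← hh, inv_smul_smul]⟩
  have hN : ∀ x y, N x y * Fintype.card X = Fintype.card G := by
    intro x y
    rw [← Finset.card_univ (α := G),
      Finset.card_eq_sum_card_fiberwise (f := fun g : G => g • x) (t := Finset.univ)
        (fun _ _ => Finset.mem_coe.2 (Finset.mem_univ _))]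
    rw [Finset.sum_congr rfl fun z _ => hconst x z y, Finset.sum_const, Finset.card_univ,
      smul_eq_mul, mul_comm]
  have hsum : ∑ g : G, (s.filter fun x => g • x ∈ u).card * Fintype.card X =
      ∑ _g : G, s.card * u.card := by
    have e1 : ∀ g : G, (s.filter fun x => g • x ∈ u).card =
        ∑ x ∈ s, ∑ y ∈ u, if g • x = y then 1 else 0 := by
      intro g
      rw [Finset.card_filter]
      refine Finset.sum_congr rfl fun x _ => ?_
      rw [Finset.sum_ite_eq]
    rw [← Finset.sum_mul, Finset.sum_congr rfl fun g _ => e1 g, Finset.sum_comm, Finset.sum_mul,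
      Finset.sum_const, Finset.card_univ]
    have e2 : ∀ x ∈ s, (∑ g : G, ∑ y ∈ u, if g • x = y then 1 else 0) * Fintype.card X =
        u.card * Fintype.card G := by
      intro x _
      rw [Finset.sum_comm, Finset.sum_mul]
      rw [Finset.sum_congr rfl (g := fun _ => Fintype.card G), Finset.sum_const, smul_eq_mul]
      intro y _
      rw [← Finset.card_filter]
      exact hN x y
    rw [Finset.sum_congr rfl e2, Finset.sum_const, smul_eq_mul, smul_eq_mul]
    ring
  obtain ⟨g, -, hg⟩ := Finset.exists_le_of_sum_le Finset.univ_nonempty hsum.le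
  exact ⟨g, hg⟩

/-- The group of permutations of the minimal vectors that are given by automorphisms of the
lattice. -/
def minimalPerms : Subgroup (Equiv.Perm leechMinimalVectors) where
  carrier := {π | ∃ g, IsLeechAut g ∧ ∀ v, ((π v : leechMinimalVectors) : EuclideanSpace ℝ (Fin 24))
    = g v}
  one_mem' := ⟨_, IsLeechAut.refl, fun _ => rfl⟩
  mul_mem' := by
    rintro π ρ ⟨g, hg, h1⟩ ⟨h, hh, h2⟩
    refine ⟨h.trans g, hh.trans hg, fun v => ?_⟩
    rw [Equiv.Perm.mul_apply, h1, h2]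
    rfl
  inv_mem' := by
    rintro π ⟨g, hg, h⟩
    refine ⟨g.symm, hg.symm, fun v => ?_⟩
    apply g.injective
    rw [g.apply_symm_apply, ← h]
    exact congrArg Subtype.val (π.apply_symm_apply v)

/-- An automorphism of the lattice as a permutation of the minimal vectors. -/
noncomputable def minimalPerm
    (g : EuclideanSpace ℝ (Fin 24) ≃ₗᵢ[ℝ] EuclideanSpace ℝ (Fin 24)) (hg : IsLeechAut g) :
    Equiv.Perm leechMinimalVectors :=
  g.toEquiv.subtypeEquiv fun _ => hg.mem_minimal_iff.symm

instance : MulAction.IsPretransitive minimalPerms leechMinimalVectors where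
  exists_smul_eq v w := by
    obtain ⟨g, hg, h⟩ := leechConj_of_minimal v.2 w.2
    exact ⟨⟨minimalPerm g hg, g, hg, fun _ => rfl⟩, Subtype.ext h⟩

/-- Some translate of `S` meets `U` in at most the average number of points. -/
theorem exists_isLeechAut_ncard_inter_le {S U : Set (EuclideanSpace ℝ (Fin 24))}
    (hS : S ⊆ leechMinimalVectors) (hU : U ⊆ leechMinimalVectors) :
    ∃ g, IsLeechAut g ∧ (g '' S ∩ U).ncard * 196560 ≤ S.ncard * U.ncard := by
  classical
  have : Fintype leechMinimalVectors := finite_leechMinimalVectors.fintype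
  -- Averaging over induced permutations of a finite set gives a finite group at once, without a
  -- separate proof that the lattice has finitely many automorphisms.
  have : Fintype minimalPerms := Fintype.ofFinite _
  let s : Finset leechMinimalVectors := Finset.univ.filter fun v => (v : EuclideanSpace ℝ _) ∈ S
  let u : Finset leechMinimalVectors := Finset.univ.filter fun v => (v : EuclideanSpace ℝ _) ∈ U
  obtain ⟨⟨π, g, hg, h⟩, hle⟩ := exists_smul_inter_card_mul_le (G := minimalPerms) s u
  have hcard : ∀ (T : Set (EuclideanSpace ℝ (Fin 24))) (t : Finset leechMinimalVectors),
      T ⊆ leechMinimalVectors → (∀ v, v ∈ t ↔ (v : EuclideanSpace ℝ (Fin 24)) ∈ T) →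
      T.ncard = t.card := by
    intro T t hT ht
    have e : T = Subtype.val '' (t : Set leechMinimalVectors) := by
      ext v
      constructor
      · exact fun hv => ⟨⟨v, hT hv⟩, (ht ⟨v, hT hv⟩).2 hv, rfl⟩
      · rintro ⟨w, hw, rfl⟩
        exact (ht w).1 hw
    rw [e, Set.ncard_image_of_injective _ Subtype.val_injective, Set.ncard_coe_finset]
  refine ⟨g, hg, ?_⟩
  have e1 : g '' S ∩ U = g '' (S ∩ g ⁻¹' U) := by
    ext v
    constructor
    · rintro ⟨⟨w, hw, rfl⟩, hv⟩
      exact ⟨w, ⟨hw, hv⟩, rfl⟩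
    · rintro ⟨w, ⟨hw, hv⟩, rfl⟩
      exact ⟨⟨w, hw, rfl⟩, hv⟩
  have e2 : Fintype.card leechMinimalVectors = 196560 := by
    rw [← ncard_leechMinimalVectors, ← Nat.card_coe_set_eq, Nat.card_eq_fintype_card]
  have e3 := hcard (S ∩ g ⁻¹' U)
    (s.filter fun v => (⟨π, g, hg, h⟩ : minimalPerms) • v ∈ u) (fun v hv => hS hv.1) (by
      intro v
      simp only [s, u, Finset.mem_filter, Finset.mem_univ, true_and, Set.mem_inter_iff,
        Set.mem_preimage, ← h]
      rfl)
  rw [e1, Set.ncard_image_of_injective _ g.injective, hcard S s hS (by simp [s]),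
    hcard U u hU (by simp [u]), e3]
  rwa [e2] at hle

/-! ### The sequence of translates -/

/-- One choice for all used-up sets `U` allows the translates to be defined by recursion. The
identity at `∅` makes the first term `S` itself; for a `U` that contains other vectors it is only a
default. -/
theorem exists_translate_choice {S : Set (EuclideanSpace ℝ (Fin 24))}
    (hS : S ⊆ leechMinimalVectors) :
    ∃ g : Set (EuclideanSpace ℝ (Fin 24)) →
        (EuclideanSpace ℝ (Fin 24) ≃ₗᵢ[ℝ] EuclideanSpace ℝ (Fin 24)),
      g ∅ = LinearIsometryEquiv.refl ℝ _ ∧ (∀ U, IsLeechAut (g U)) ∧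
      ∀ U, U ⊆ leechMinimalVectors → (g U '' S ∩ U).ncard * 196560 ≤ S.ncard * U.ncard := by
  have key : ∀ U, ∃ g : EuclideanSpace ℝ (Fin 24) ≃ₗᵢ[ℝ] EuclideanSpace ℝ (Fin 24),
      (U = ∅ → g = LinearIsometryEquiv.refl ℝ _) ∧ IsLeechAut g ∧
      (U ⊆ leechMinimalVectors → (g '' S ∩ U).ncard * 196560 ≤ S.ncard * U.ncard) := by
    intro U
    by_cases h0 : U = ∅
    · exact ⟨_, fun _ => rfl, IsLeechAut.refl, fun _ => by simp [h0]⟩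
    · by_cases hU : U ⊆ leechMinimalVectors
      · obtain ⟨g, hg, h⟩ := exists_isLeechAut_ncard_inter_le hS hU
        exact ⟨g, fun h => absurd h h0, hg, fun _ => h⟩
      · exact ⟨_, fun _ => rfl, IsLeechAut.refl, fun h => absurd h hU⟩
  choose g h0 h1 h2 using key
  exact ⟨g, h0 ∅ rfl, h1, h2⟩

theorem IsLeechAut.image_subset {g : EuclideanSpace ℝ (Fin 24) ≃ₗᵢ[ℝ] EuclideanSpace ℝ (Fin 24)}
    (hg : IsLeechAut g) {S : Set (EuclideanSpace ℝ (Fin 24))} (hS : S ⊆ leechMinimalVectors) :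
    g '' S ⊆ leechMinimalVectors := by
  rintro _ ⟨v, hv, rfl⟩
  exact hg.mem_minimal_iff.2 (hS hv)

theorem disjoint_of_eq_diff {α : Type*} {A B : ℕ → Set α} (h : ∀ i, A i = B i \ ⋃ j < i, A j) :
    Pairwise fun i j => Disjoint (A i) (A j) := by
  have key : ∀ i j, i < j → Disjoint (A i) (A j) := by
    intro i j hij
    rw [Set.disjoint_left]
    intro x hx hx'
    rw [h j] at hx'
    exact hx'.2 (Set.mem_iUnion₂.2 ⟨i, hij, hx⟩)
  intro i j hij
  rcases lt_or_gt_of_ne hij with h | h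
  · exact key i j h
  · exact (key j i h).symm

theorem ncard_iUnion_lt {α : Type*} {A : ℕ → Set α} (hd : Pairwise fun i j => Disjoint (A i) (A j))
    (hf : ∀ i, (A i).Finite) (n : ℕ) :
    (⋃ j < n, A j).ncard = ∑ j ∈ Finset.range n, (A j).ncard := by
  induction n with
  | zero => simp
  | succ n ih =>
    have e : (⋃ j < n + 1, A j) = (⋃ j < n, A j) ∪ A n := Set.biUnion_lt_succ A n
    have hfin : (⋃ j < n, A j).Finite := (Set.finite_lt_nat n).biUnion fun j _ => hf j
    rw [e, Set.ncard_union_eq _ hfin (hf n), ih, Finset.sum_range_succ]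
    rw [Set.disjoint_left]
    intro x hx hx'
    obtain ⟨j, hj, hx⟩ := Set.mem_iUnion₂.1 hx
    exact Set.disjoint_left.1 (hd hj.ne) hx hx'

theorem exists_isTranslateSequence {S : Set (EuclideanSpace ℝ (Fin 24))}
    (hS : S ⊆ leechMinimalVectors) : ∃ A, IsTranslateSequence S A := by
  obtain ⟨g, hg0, hg, hle⟩ := exists_translate_choice hS
  -- `U n` collects the points used in the first `n` steps; each step depends on the past only
  -- through this set.
  let U : ℕ → Set (EuclideanSpace ℝ (Fin 24)) := fun n => Nat.rec ∅ (fun _ V => V ∪ g V '' S) n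
  have hU1 : ∀ n, U (n + 1) = U n ∪ g (U n) '' S := fun n => rfl
  let A : ℕ → Set (EuclideanSpace ℝ (Fin 24)) := fun n => (g (U n) '' S) \ U n
  have hU : ∀ n, U n = ⋃ j < n, A j := by
    intro n
    induction n with
    | zero => simp [U]
    | succ n ih =>
      have e : (⋃ j < n + 1, A j) = (⋃ j < n, A j) ∪ A n := Set.biUnion_lt_succ A n
      rw [e, ← ih, hU1, Set.union_sdiff_self]
  have hA : ∀ n, A n = (g (U n) '' S) \ ⋃ j < n, A j := fun n => by rw [← hU]
  have hsub : ∀ n, A n ⊆ leechMinimalVectors := fun n =>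
    Set.sdiff_subset.trans ((hg _).image_subset hS)
  have hUsub : ∀ n, U n ⊆ leechMinimalVectors := by
    intro n
    rw [hU]
    exact Set.iUnion₂_subset fun j _ => hsub j
  have hfin : ∀ n, (A n).Finite := fun n => finite_leechMinimalVectors.subset (hsub n)
  refine ⟨A, ?_, fun n => ⟨g (U n), hg _, hA n⟩, fun n => ?_⟩
  · have : U 0 = ∅ := rfl
    simp only [A, this, hg0]
    simp
  · have e1 := ncard_iUnion_lt (disjoint_of_eq_diff hA) hfin n
    rw [← hU] at e1
    have e2 := hle (U n) (hUsub n)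
    have e3 : (g (U n) '' S ∩ U n).ncard + (A n).ncard = S.ncard := by
      rw [Set.ncard_inter_add_ncard_sdiff_eq_ncard _ _
        (finite_leechMinimalVectors.subset ((hg _).image_subset hS)),
        Set.ncard_image_of_injective _ (g _).injective]
    rw [← Nat.cast_sum, ← e1]
    have e4 : ((g (U n) '' S ∩ U n).ncard : ℝ) * 196560 ≤ S.ncard * (U n).ncard := by
      exact_mod_cast e2
    have e5 : ((g (U n) '' S ∩ U n).ncard : ℝ) + (A n).ncard = S.ncard := by exact_mod_cast e3
    linarith

section TranslateSequence

variable {S : Set (EuclideanSpace ℝ (Fin 24))} {A : ℕ → Set (EuclideanSpace ℝ (Fin 24))}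

theorem IsTranslateSequence.pairwise_disjoint (h : IsTranslateSequence S A) :
    Pairwise fun i j => Disjoint (A i) (A j) := by
  choose g _ hA using h.2.1
  exact disjoint_of_eq_diff hA

theorem IsTranslateSequence.isAdmissible (h : IsTranslateSequence S A) (hS : IsAdmissible S)
    (i : ℕ) : IsAdmissible (A i) := by
  obtain ⟨g, hg, hA⟩ := h.2.1 i
  have hsub : A i ⊆ g '' S := hA ▸ Set.sdiff_subset
  refine ⟨hsub.trans (IsLeechAut.image_subset hg hS.1), fun x hx y hy hxy => ?_⟩
  obtain ⟨v, hv, rfl⟩ := hsub hx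
  obtain ⟨w, hw, rfl⟩ := hsub hy
  rw [g.inner_map_map]
  exact hS.2 v hv w hw fun e => hxy (by rw [e])

/-- Were `-x` removed because it lies in an earlier set, `x` would lie in that antipodal set too and
would have been removed. -/
theorem IsTranslateSequence.isAntipodal (h : IsTranslateSequence S A) (hS : IsAntipodal S)
    (i : ℕ) : IsAntipodal (A i) := by
  induction i using Nat.strong_induction_on with
  | _ i ih =>
    obtain ⟨g, hg, hA⟩ := h.2.1 i
    rw [hA]
    rintro _ ⟨⟨v, hv, rfl⟩, hx⟩
    refine ⟨⟨-v, hS v hv, map_neg g v⟩, fun hneg => hx ?_⟩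
    obtain ⟨j, hj, hneg⟩ := Set.mem_iUnion₂.1 hneg
    refine Set.mem_iUnion₂.2 ⟨j, hj, ?_⟩
    have := ih j hj _ hneg
    rwa [neg_neg] at this

end TranslateSequence

/-- An antipodal set of nonzero vectors has even size. -/
theorem even_ncard_of_isAntipodal {S : Set (EuclideanSpace ℝ (Fin 24))} (hS : IsAntipodal S)
    (hf : S.Finite) (h0 : 0 ∉ S) : Even S.ncard := by
  classical
  rw [Set.ncard_eq_toFinset_card _ hf, ← ZMod.natCast_eq_zero_iff_even, Finset.card_eq_sum_ones,
    Nat.cast_sum]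
  refine Finset.sum_involution (fun x _ => -x) (fun x _ => by decide) (fun x hx _ e => ?_)
    (fun x hx => ?_) fun x _ => neg_neg x
  · have e2 : (2 : ℝ) • x = 0 := by
      rw [two_smul]
      nth_rewrite 1 [← e]
      exact neg_add_cancel x
    rw [(smul_eq_zero.1 e2).resolve_left two_ne_zero] at hx
    exact h0 (by simpa using hx)
  · simpa using hS x (by simpa using hx)

/-! ### The size of the translates -/

/-- The lower bound for the number of points in the first sets of a sequence of translates of an
antipodal set with `2 * p` points. -/
def translateBound (p : ℕ) : ℕ → ℕ
  | 0 => 0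
  -- Adding 196559 before the division rounds up half the size of the next set; evenness of that
  -- size justifies the factor 2 outside.
  | n + 1 => translateBound p n + 2 * ((p * (196560 - translateBound p n) + 196559) / 196560)

theorem IsTranslateSequence.even_ncard {S : Set (EuclideanSpace ℝ (Fin 24))}
    {A : ℕ → Set (EuclideanSpace ℝ (Fin 24))} (h : IsTranslateSequence S A) (hS : IsAdmissible S)
    (ha : IsAntipodal S) (i : ℕ) : Even (A i).ncard := by
  have h1 := (h.isAdmissible hS i).1
  refine even_ncard_of_isAntipodal (h.isAntipodal ha i) (finite_leechMinimalVectors.subset h1) ?_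
  intro h0
  have := norm_of_mem_minimal (h1 h0)
  simp at this

/-- The actual sum may exceed the bound, which weakens the guarantee for the next set. But raising
the sum by `2 δ` lowers the guaranteed half-size by `2 p δ / 196560 ≤ δ`, as `p ≤ 98280`; so the
surplus outweighs the loss. Parity is carried along so that one can calculate with halves. -/
theorem IsTranslateSequence.translateBound_le {S : Set (EuclideanSpace ℝ (Fin 24))}
    {A : ℕ → Set (EuclideanSpace ℝ (Fin 24))} (h : IsTranslateSequence S A) (hS : IsAdmissible S)
    (ha : IsAntipodal S) {p : ℕ} (hp : S.ncard = 2 * p) (hp' : p ≤ 98280) (n : ℕ) :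
    translateBound p n ≤ ∑ j ∈ Finset.range n, (A j).ncard ∧ Even (translateBound p n) ∧
      Even (∑ j ∈ Finset.range n, (A j).ncard) := by
  induction n with
  | zero => simp [translateBound]
  | succ n ih =>
    obtain ⟨h1, ⟨t, ht⟩, ⟨s, hs⟩⟩ := ih
    obtain ⟨k, hk⟩ := h.even_ncard hS ha n
    have h2 := h.2.2 n
    rw [hp, ← Nat.cast_sum, hs, hk] at h2
    push_cast at h2
    have h3 : (p : ℤ) * (196560 - 2 * s) ≤ 196560 * k := by
      have : ((p : ℝ)) * (196560 - 2 * s) ≤ 196560 * k := by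
        have e : (p : ℝ) * (196560 - 2 * s) = 196560 * (2 * p * (1 - (s + s) / 196560)) / 2 := by
          field_simp
          ring
        rw [e]
        linarith
      rw [← Int.cast_le (R := ℝ)]
      push_cast
      exact this
    rw [Finset.sum_range_succ, translateBound, hs, hk, ht]
    set c := (p * (196560 - (t + t)) + 196559) / 196560 with hc
    refine ⟨?_, ⟨t + c, by ring⟩, ⟨s + k, by ring⟩⟩
    have h4 : 196560 * c ≤ p * (196560 - (t + t)) + 196559 := Nat.mul_div_le _ _
    rcases le_or_gt (t + t) 196560 with h5 | h5
    · have h6 : (196560 : ℤ) * c ≤ p * (196560 - 2 * t) + 196559 := by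
        zify [h5] at h4
        linarith
      have h7 : t ≤ s := by omega
      have h8 : (p : ℤ) * (2 * (s - t)) ≤ 98280 * (2 * (s - t)) := by
        have : (t : ℤ) ≤ s := by exact_mod_cast h7
        exact mul_le_mul_of_nonneg_right (by exact_mod_cast hp') (by linarith)
      have h9 : (196560 : ℤ) * (c - 1) < 196560 * (k + s - t) := by linarith
      omega
    -- Truncated subtraction gives 0, and then the increment is 0 as well.
    · rw [show 196560 - (t + t) = 0 by omega] at h4
      omega

theorem kissingBound_eq (A : ℕ → Set (EuclideanSpace ℝ (Fin 24))) (a b : ℕ) :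
    kissingBound A a b = 196560 + ∑ i ∈ Finset.range a, (A i).ncard +
      ∑ i ∈ Finset.range (a + b), (A i).ncard := by
  rw [kissingBound, ← Finset.sum_range_add_sum_Ico _ (Nat.le_add_right a b)]
  ring

theorem IsTranslateSequence.le_kissingBound {S : Set (EuclideanSpace ℝ (Fin 24))}
    {A : ℕ → Set (EuclideanSpace ℝ (Fin 24))} (h : IsTranslateSequence S A) (hS : IsAdmissible S)
    (ha : IsAntipodal S) {p : ℕ} (hp : S.ncard = 2 * p) (hp' : p ≤ 98280) (a b : ℕ) :
    196560 + translateBound p a + translateBound p (a + b) ≤ kissingBound A a b := by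
  rw [kissingBound_eq]
  have h1 := (h.translateBound_le hS ha hp hp' a).1
  have h2 := (h.translateBound_le hS ha hp hp' (a + b)).1
  omega

theorem IsTranslateSequence.le_kissingBound_of_480 {S : Set (EuclideanSpace ℝ (Fin 24))}
    {A : ℕ → Set (EuclideanSpace ℝ (Fin 24))} (h : IsTranslateSequence S A) (hS : IsAdmissible S)
    (ha : IsAntipodal S) (hp : S.ncard = 480) :
    197040 ≤ kissingBound A 0 1 ∧ 198480 ≤ kissingBound A 2 0 ∧
      199912 ≤ kissingBound A 2 3 ∧ 204188 ≤ kissingBound A 8 0 ∧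
      207930 ≤ kissingBound A 8 8 ∧ 219008 ≤ kissingBound A 24 0 ∧
      230872 ≤ kissingBound A 24 27 := by
  have key := h.le_kissingBound hS ha (p := 240) hp (by norm_num)
  exact ⟨le_trans (by decide +kernel) (key 0 1), le_trans (by decide +kernel) (key 2 0),
    le_trans (by decide +kernel) (key 2 3), le_trans (by decide +kernel) (key 8 0),
    le_trans (by decide +kernel) (key 8 8), le_trans (by decide +kernel) (key 24 0),
    le_trans (by decide +kernel) (key 24 27)⟩

theorem IsTranslateSequence.le_kissingBound_of_288 {S : Set (EuclideanSpace ℝ (Fin 24))}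
    {A : ℕ → Set (EuclideanSpace ℝ (Fin 24))} (h : IsTranslateSequence S A) (hS : IsAdmissible S)
    (ha : IsAntipodal S) (hp : S.ncard = 288) :
    196848 ≤ kissingBound A 0 1 ∧ 197712 ≤ kissingBound A 2 0 ∧
      198576 ≤ kissingBound A 2 3 ∧ 201156 ≤ kissingBound A 8 0 ∧
      203430 ≤ kissingBound A 8 8 ∧ 210200 ≤ kissingBound A 24 0 ∧
      217588 ≤ kissingBound A 24 27 := by
  have key := h.le_kissingBound hS ha (p := 144) hp (by norm_num)
  exact ⟨le_trans (by decide +kernel) (key 0 1), le_trans (by decide +kernel) (key 2 0),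
    le_trans (by decide +kernel) (key 2 3), le_trans (by decide +kernel) (key 8 0),
    le_trans (by decide +kernel) (key 8 8), le_trans (by decide +kernel) (key 24 0),
    le_trans (by decide +kernel) (key 24 27)⟩

/-! ### Partitioned kissing configurations in small dimensions -/

section Kissing

variable {E : Type*} [NormedAddCommGroup E] [InnerProductSpace ℝ E]

theorem pi_div_three_le_angle_iff {x y : E} {r : ℝ} (hr : 0 < r) (hx : ‖x‖ = r) (hy : ‖y‖ = r) :
    Real.pi / 3 ≤ InnerProductGeometry.angle x y ↔ inner ℝ x y ≤ r ^ 2 / 2 := by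
  have h3 : Real.pi / 3 = Real.arccos (1 / 2) := by
    rw [← Real.cos_pi_div_three, Real.arccos_cos] <;> linarith [Real.pi_pos]
  have hr2 : 0 < r * r := by positivity
  have h1 := abs_le.1 (abs_real_inner_div_norm_mul_norm_le_one x y)
  rw [hx, hy] at h1
  rw [h3, InnerProductGeometry.angle, hx, hy,
    Real.strictAntiOn_arccos.le_iff_ge ⟨by norm_num, by norm_num⟩ ⟨h1.1, h1.2⟩, div_le_iff₀ hr2]
  constructor <;> intro h <;> nlinarith

theorem isKissingConfiguration_iff {r : ℝ} (hr : 0 < r) {T : Set E} :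
    IsKissingConfiguration r T ↔
      (∀ x ∈ T, ‖x‖ = r) ∧ ∀ x ∈ T, ∀ y ∈ T, x ≠ y → inner ℝ x y ≤ r ^ 2 / 2 := by
  refine and_congr_right fun h => ?_
  refine forall₂_congr fun x hx => forall₂_congr fun y hy => imp_congr_right fun _ => ?_
  exact pi_div_three_le_angle_iff hr (h x hx) (h y hy)

end Kissing

/-- The inner product of two integral vectors with respect to a diagonal form. -/
def weightedDot : List ℤ → List ℤ → List ℤ → ℤ
  | w :: ws, x :: xs, y :: ys => w * x * y + weightedDot ws xs ys
  | _, _, _ => 0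

theorem weightedDot_comm (w x y : List ℤ) : weightedDot w x y = weightedDot w y x := by
  induction w generalizing x y with
  | nil => simp [weightedDot]
  | cons a w ih =>
    cases x <;> cases y <;> simp only [weightedDot, ih]
    ring

theorem weightedDot_eq_sum {d : ℕ} {w x y : List ℤ} (hw : w.length = d) :
    weightedDot w x y = ∑ i : Fin d, w.getD i 0 * x.getD i 0 * y.getD i 0 := by
  subst hw
  induction w generalizing x y with
  | nil => simp [weightedDot]
  | cons a w ih =>
    rcases x with _ | ⟨b, x⟩
    · simp [weightedDot]
    · rcases y with _ | ⟨c, y⟩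
      · simp [weightedDot]
      · simp only [List.length_cons]
        rw [weightedDot, ih, Fin.sum_univ_succ]
        simp

/-- The point with coordinates `x i * √(w i / 12)`. -/
noncomputable def weightedPoint (d : ℕ) (w x : List ℤ) : EuclideanSpace ℝ (Fin d) :=
  WithLp.toLp 2 fun i => (x.getD i 0 : ℝ) * Real.sqrt ((w.getD i 0 : ℝ) / 12)

theorem inner_weightedPoint {d : ℕ} {w : List ℤ} (hw : w.length = d) (hpos : ∀ a ∈ w, 0 ≤ a)
    (x y : List ℤ) :
    inner ℝ (weightedPoint d w x) (weightedPoint d w y) = (weightedDot w x y : ℝ) / 12 := by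
  rw [weightedDot_eq_sum hw, PiLp.inner_apply]
  push_cast
  rw [Finset.sum_div]
  refine Finset.sum_congr rfl fun i _ => ?_
  have h : (0 : ℝ) ≤ (w.getD i 0 : ℝ) / 12 := by
    have h1 : 0 ≤ w.getD i 0 := by
      rw [List.getD_eq_getElem _ _ (by rw [hw]; exact i.2)]
      exact hpos _ (List.getElem_mem _)
    positivity
  have h2 := Real.mul_self_sqrt h
  simp only [weightedPoint, RCLike.inner_apply, conj_trivial]
  linear_combination (x.getD i 0 : ℝ) * (y.getD i 0 : ℝ) * h2

/-- The conditions for a list of lists of integral vectors to give a partitioned kissing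
configuration with parts of size three and two. -/
def IsPartitionedList (a b : ℕ) (w : List ℤ) (L : List (List (List ℤ))) : Prop :=
  (∀ c ∈ w, 0 ≤ c) ∧ (∀ i < a + b, (L.getD i []).length = if i < a then 3 else 2) ∧
  (L.Pairwise fun p q => ∀ x ∈ p, ∀ y ∈ q, weightedDot w x y ≤ 6) ∧
  ∀ p ∈ L, (p.Pairwise fun x y => weightedDot w x y ≤ -6) ∧ ∀ x ∈ p, weightedDot w x x = 12

instance (a b : ℕ) (w : List ℤ) (L : List (List (List ℤ))) :
    Decidable (IsPartitionedList a b w L) := by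
  unfold IsPartitionedList
  infer_instance

/-- In the scale of `weightedPoint`, the values `1, 1/2, -1/2` become `12, 6, -6`, and irrational
coordinates are absorbed in the weights, so the hypothesis is decidable. Distinctness is automatic:
equal points would have product 12, above both bounds. -/
theorem exists_isPartitionedKissing {a b : ℕ} {w : List ℤ} {L : List (List (List ℤ))}
    (hL : IsPartitionedList a b w L) (hlen : a + b ≤ L.length) :
    ∃ T, IsPartitionedKissing w.length a b T := by
  obtain ⟨hw, hcard, hP, hQ⟩ := hL
  have hin := inner_weightedPoint rfl hw
  have hget : ∀ i : Fin (a + b), L.getD i [] ∈ L := by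
    intro i
    rw [List.getD_eq_getElem _ _ (i.2.trans_le hlen)]
    exact List.getElem_mem _
  have hsame : ∀ p ∈ L, ∀ x ∈ p, ∀ y ∈ p, x ≠ y → weightedDot w x y ≤ -6 := by
    intro p hp x hx y hy hxy
    have : Std.Symm fun x y => weightedDot w x y ≤ -6 :=
      ⟨fun x y h => by rwa [weightedDot_comm]⟩
    exact (hQ p hp).1.forall hx hy hxy
  have hdiff : ∀ i j : Fin (a + b), i ≠ j → ∀ x ∈ L.getD i [], ∀ y ∈ L.getD j [],
      weightedDot w x y ≤ 6 := by
    have key : ∀ i j : Fin (a + b), i < j → ∀ x ∈ L.getD i [], ∀ y ∈ L.getD j [],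
        weightedDot w x y ≤ 6 := by
      intro i j hij
      rw [List.getD_eq_getElem _ _ (i.2.trans_le hlen),
        List.getD_eq_getElem _ _ (j.2.trans_le hlen)]
      exact List.pairwise_iff_getElem.1 hP i j _ _ hij
    intro i j hij x hx y hy
    rcases lt_or_gt_of_ne hij with h | h
    · exact key i j h x hx y hy
    · rw [weightedDot_comm]
      exact key j i h y hy x hx
  let T : Fin (a + b) → Set (EuclideanSpace ℝ (Fin w.length)) := fun i =>
    weightedPoint w.length w '' {x | x ∈ L.getD i []}
  have heq : ∀ p ∈ L, ∀ x ∈ p, ∀ y, weightedPoint w.length w x = weightedPoint w.length w y →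
      weightedDot w x y = 12 := by
    intro p hp x hx y h
    have h1 := hin x y
    rw [← h, hin, (hQ p hp).2 x hx] at h1
    have h2 : (weightedDot w x y : ℝ) = 12 := by
      push_cast at h1
      linarith
    exact_mod_cast h2
  refine ⟨T, (isKissingConfiguration_iff one_pos).2 ⟨?_, ?_⟩, ?_, ?_, ?_⟩
  · intro v hv
    obtain ⟨i, x, hx, rfl⟩ := Set.mem_iUnion.1 hv
    have h1 := hin x x
    rw [(hQ _ (hget i)).2 x hx, real_inner_self_eq_norm_sq] at h1
    norm_num at h1
    exact h1.resolve_right (by linarith [norm_nonneg (weightedPoint w.length w x)])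
  · intro v hv v' hv' hne
    obtain ⟨i, x, hx, rfl⟩ := Set.mem_iUnion.1 hv
    obtain ⟨j, y, hy, rfl⟩ := Set.mem_iUnion.1 hv'
    rw [hin]
    have h6 : weightedDot w x y ≤ 6 := by
      by_cases hij : i = j
      · subst hij
        have := hsame _ (hget i) x hx y hy fun e => hne (by rw [e])
        omega
      · exact hdiff i j hij x hx y hy
    have h6' : (weightedDot w x y : ℝ) ≤ 6 := by exact_mod_cast h6
    linarith
  · intro i j hij
    refine Set.disjoint_left.2 ?_
    rintro _ ⟨x, hx, rfl⟩ ⟨y, hy, h⟩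
    have h1 := heq _ (hget i) x hx y h.symm
    have h2 := hdiff i j hij x hx y hy
    omega
  · intro i
    have hnd : (L.getD i []).Nodup := by
      refine (hQ _ (hget i)).1.imp_of_mem fun {x y} hx hy h e => ?_
      subst e
      have := (hQ _ (hget i)).2 x hx
      omega
    have hfin : {x | x ∈ L.getD i []} = ((L.getD i []).toFinset : Set (List ℤ)) := by
      ext x
      simp
    rw [← hcard i i.2, Set.InjOn.ncard_image, hfin, Set.ncard_coe_finset,
      List.toFinset_card_of_nodup hnd]
    intro x hx y hy h
    by_contra hxy
    have h1 := heq _ (hget i) x hx y h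
    have h2 := hsame _ (hget i) x hx y hy hxy
    omega
  · rintro i _ ⟨x, hx, rfl⟩ _ ⟨y, hy, rfl⟩ hne
    rw [hin]
    have h6 := hsame _ (hget i) x hx y hy fun e => hne (by rw [e])
    have h6' : (weightedDot w x y : ℝ) ≤ -6 := by exact_mod_cast h6
    linarith

/-- The triples of roots in the root system `D₄`. -/
def rootTriplesD4 : List (List (List ℤ)) :=
  [[[-1, -1, 0, 0], [0, 1, -1, 0], [1, 0, 1, 0]],
    [[-1, 0, -1, 0], [0, -1, 1, 0], [1, 1, 0, 0]],
    [[-1, 0, 0, -1], [0, 0, 1, 1], [1, 0, -1, 0]],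
    [[-1, 0, 0, 1], [0, 1, 0, -1], [1, -1, 0, 0]],
    [[-1, 0, 1, 0], [0, 0, -1, -1], [1, 0, 0, 1]],
    [[-1, 1, 0, 0], [0, -1, 0, 1], [1, 0, 0, -1]],
    [[0, -1, -1, 0], [0, 0, 1, -1], [0, 1, 0, 1]],
    [[0, -1, 0, -1], [0, 0, -1, 1], [0, 1, 1, 0]]]

/-- The rotation by `2π/3` in each of the planes of an integral vector for the weights `3, 1`. -/
def rotate : List ℤ → List ℤ
  | a :: b :: l => (-a - b) / 2 :: (3 * a - b) / 2 :: rotate l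
  | l => l

/-- The triples of roots in the root system `E₆`, glued from three root systems `A₂`. -/
def rootTriplesE6 : List (List (List ℤ)) :=
  -- There are two rotation orbits of roots in each A₂. The 54 glue vectors have all three
  -- components in the same one of two orbits; fixing the first component selects 18
  -- representatives. Together these give 24 orbits, and vectors rotated by `2π/3` have inner
  -- product `-1/2`.
  ([[2, 0, 0, 0, 0, 0], [-2, 0, 0, 0, 0, 0], [0, 0, 2, 0, 0, 0], [0, 0, -2, 0, 0, 0],
      [0, 0, 0, 0, 2, 0], [0, 0, 0, 0, -2, 0]] ++
    [[[0, 2], [-1, -1], [1, -1]], [[0, -2], [1, 1], [-1, 1]]].flatMap fun (g : List (List ℤ)) =>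
      g.flatMap fun u => g.map fun v => g.headD [] ++ u ++ v).map
    fun x => [x, rotate x, rotate (rotate x)]

/-- The pairs of opposite roots in the root system `E₇` outside a subsystem `E₆`. -/
def rootPairsE7 : List (List (List ℤ)) :=
  ([[0, 2], [-1, -1], [1, -1]].flatMap fun u => [[0, -2], [1, 1], [-1, 1]].flatMap fun v =>
    [u ++ v ++ [0, 0], [0, 0] ++ u ++ v, v ++ [0, 0] ++ u]).map
    fun x => [x ++ [1], (x ++ [1]).map fun a => -a]

theorem exists_isPartitionedKissing_one : ∃ T, IsPartitionedKissing 1 0 1 T :=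
  exists_isPartitionedKissing (w := [12]) (L := [[[1], [-1]]]) (by decide +kernel) (by decide)

theorem exists_isPartitionedKissing_two : ∃ T, IsPartitionedKissing 2 2 0 T :=
  exists_isPartitionedKissing (w := [3, 9])
    (L := [[[2, 0], [-1, 1], [-1, -1]], [[-2, 0], [1, -1], [1, 1]]]) (by decide +kernel) (by decide)

/-- Among the roots of A₃ in the form D₃, the hexagon orthogonal to `(1, 1, 1)` gives two triples
and the other six roots three opposite pairs. -/
theorem exists_isPartitionedKissing_three : ∃ T, IsPartitionedKissing 3 2 3 T :=
  exists_isPartitionedKissing (w := [6, 6, 6])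
    (L := [[[1, -1, 0], [0, 1, -1], [-1, 0, 1]], [[-1, 1, 0], [0, -1, 1], [1, 0, -1]],
      [[1, 1, 0], [-1, -1, 0]], [[1, 0, 1], [-1, 0, -1]], [[0, 1, 1], [0, -1, -1]]])
    (by decide +kernel) (by decide)

theorem exists_isPartitionedKissing_four : ∃ T, IsPartitionedKissing 4 8 0 T :=
  exists_isPartitionedKissing (w := [6, 6, 6, 6]) (L := rootTriplesD4) (by decide +kernel)
    (by decide)

/-- D₅ consists of D₄ on the first four coordinates and 16 further roots in opposite pairs. -/
theorem exists_isPartitionedKissing_five : ∃ T, IsPartitionedKissing 5 8 8 T :=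
  exists_isPartitionedKissing (w := [6, 6, 6, 6, 6])
    (L := rootTriplesD4.map (fun p => p.map (· ++ [0])) ++
      [[[1, 0, 0, 0, 1], [-1, 0, 0, 0, -1]], [[1, 0, 0, 0, -1], [-1, 0, 0, 0, 1]],
      [[0, 1, 0, 0, 1], [0, -1, 0, 0, -1]], [[0, 1, 0, 0, -1], [0, -1, 0, 0, 1]],
      [[0, 0, 1, 0, 1], [0, 0, -1, 0, -1]], [[0, 0, 1, 0, -1], [0, 0, -1, 0, 1]],
      [[0, 0, 0, 1, 1], [0, 0, 0, -1, -1]], [[0, 0, 0, 1, -1], [0, 0, 0, -1, 1]]])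
    (by decide +kernel) (by decide)

theorem exists_isPartitionedKissing_six : ∃ T, IsPartitionedKissing 6 24 0 T :=
  exists_isPartitionedKissing (w := [3, 1, 3, 1, 3, 1]) (L := rootTriplesE6) (by decide +kernel)
    (by decide +kernel)

theorem exists_isPartitionedKissing_seven : ∃ T, IsPartitionedKissing 7 24 27 T :=
  exists_isPartitionedKissing (w := [3, 1, 3, 1, 3, 1, 4])
    (L := rootTriplesE6.map (fun p => p.map (· ++ [0])) ++ rootPairsE7) (by decide +kernel)
    (by decide +kernel)

/-! ### The modified configuration -/

theorem inner_lift {E F : Type*} [NormedAddCommGroup E] [InnerProductSpace ℝ E]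
    [NormedAddCommGroup F] [InnerProductSpace ℝ F] (x x' : E) (y y' : F) :
    inner ℝ (WithLp.toLp 2 (Real.sqrt (2 / 3) • x, Real.sqrt (4 / 3) • y))
      (WithLp.toLp 2 (Real.sqrt (2 / 3) • x', Real.sqrt (4 / 3) • y')) =
      2 / 3 * inner ℝ x x' + 4 / 3 * inner ℝ y y' := by
  rw [WithLp.prod_inner_apply]
  simp only [real_inner_smul_left, real_inner_smul_right]
  rw [← mul_assoc, ← mul_assoc, Real.mul_self_sqrt (by norm_num), Real.mul_self_sqrt (by norm_num)]

theorem inner_base {E F : Type*} [NormedAddCommGroup E] [InnerProductSpace ℝ E]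
    [NormedAddCommGroup F] [InnerProductSpace ℝ F] (x x' : E) :
    inner ℝ (WithLp.toLp 2 (x, (0 : F))) (WithLp.toLp 2 (x', (0 : F))) = inner ℝ x x' := by
  rw [WithLp.prod_inner_apply]
  simp

theorem inner_base_lift {E F : Type*} [NormedAddCommGroup E] [InnerProductSpace ℝ E]
    [NormedAddCommGroup F] [InnerProductSpace ℝ F] (x x' : E) (y : F) :
    inner ℝ (WithLp.toLp 2 (x, (0 : F)))
      (WithLp.toLp 2 (Real.sqrt (2 / 3) • x', Real.sqrt (4 / 3) • y)) =
      Real.sqrt (2 / 3) * inner ℝ x x' := by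
  rw [WithLp.prod_inner_apply]
  simp [real_inner_smul_right]

theorem norm_eq_of_inner_self {E : Type*} [NormedAddCommGroup E] [InnerProductSpace ℝ E] {x : E}
    {r : ℝ} (hr : 0 ≤ r) (h : inner ℝ x x = r ^ 2) : ‖x‖ = r := by
  rw [real_inner_self_eq_norm_sq] at h
  exact (sq_eq_sq₀ (norm_nonneg x) hr).1 h

section Lifted

variable {d a b : ℕ} {A : ℕ → Set (EuclideanSpace ℝ (Fin 24))}
  {T : Fin (a + b) → Set (EuclideanSpace ℝ (Fin d))}

theorem IsPartitionedKissing.norm_eq (hT : IsPartitionedKissing d a b T) {i : Fin (a + b)}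
    {y : EuclideanSpace ℝ (Fin d)} (hy : y ∈ T i) : ‖y‖ = 1 :=
  hT.1.1 y (Set.mem_iUnion.2 ⟨i, hy⟩)

theorem isKissingConfiguration_lifted (hA : ∀ i, IsAdmissible (A i))
    (hd : Pairwise fun i j => Disjoint (A i) (A j)) (hT : IsPartitionedKissing d a b T) :
    IsKissingConfiguration 2 (liftedConfiguration A T) := by
  have hself : ∀ x ∈ leechMinimalVectors, inner ℝ x x = (4 : ℝ) := fun x hx => by
    rw [real_inner_self_eq_norm_sq, norm_of_mem_minimal hx]
    norm_num
  have hselfT : ∀ i, ∀ y ∈ T i, inner ℝ y y = (1 : ℝ) := fun i y hy => by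
    rw [real_inner_self_eq_norm_sq, hT.norm_eq hy]
    norm_num
  have hcross : ∀ x ∈ leechMinimalVectors \ ⋃ i : Fin (a + b), A i.val, ∀ i : Fin (a + b),
      ∀ x' ∈ A i.val, Real.sqrt (2 / 3) * inner ℝ x x' ≤ 2 := by
    intro x hx i x' hx'
    have h1 : inner ℝ x x' ≤ (2 : ℝ) := inner_le_two hx.1 ((hA i).1 hx') fun e =>
      hx.2 (Set.mem_iUnion.2 ⟨i, e ▸ hx'⟩)
    have h2 : Real.sqrt (2 / 3) ≤ 1 := Real.sqrt_le_one.2 (by norm_num)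
    have h3 := Real.sqrt_nonneg (2 / 3)
    nlinarith
  refine (isKissingConfiguration_iff two_pos).2 ⟨?_, ?_⟩
  · rintro p (⟨x, hx, rfl⟩ | ⟨i, x, hx, y, hy, rfl⟩)
    · refine norm_eq_of_inner_self two_pos.le ?_
      rw [inner_base, hself x hx.1]
      norm_num
    · refine norm_eq_of_inner_self two_pos.le ?_
      rw [inner_lift, hself x ((hA i).1 hx), hselfT i y hy]
      norm_num
  · rintro p (⟨x, hx, rfl⟩ | ⟨i, x, hx, y, hy, rfl⟩) q
      (⟨x', hx', rfl⟩ | ⟨j, x', hx', y', hy', rfl⟩) hne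
    · rw [inner_base]
      have := inner_le_two hx.1 hx'.1 fun e => hne (by rw [e])
      linarith
    · rw [inner_base_lift]
      have := hcross x hx j x' hx'
      linarith
    · rw [real_inner_comm, inner_base_lift]
      have := hcross x' hx' i x hx
      linarith
    · rw [inner_lift]
      by_cases hij : i = j
      · subst hij
        by_cases hxx : x = x'
        · subst hxx
          -- Same `x`: `2/3 * 4 + 4/3 * (-1/2) = 2`.
          have hyy : y ≠ y' := fun e => hne (by rw [e])
          have h1 := hT.2.2.2 i y hy y' hy' hyy
          rw [hself x ((hA i).1 hx)]
          linarith
        -- Same part, different `x`: `2/3 * 1 + 4/3 * 1 = 2`. This is where admissibility enters; `y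
        -- = y'` is allowed.
        · have h1 := (hA i).2 x hx x' hx' hxx
          have h2 : inner ℝ y y' ≤ (1 : ℝ) := by
            have := real_inner_le_norm y y'
            rwa [hT.norm_eq hy, hT.norm_eq hy', one_mul] at this
          linarith
      -- Different parts: `2/3 * 2 + 4/3 * (1/2) = 2`, since disjointness makes both components
      -- differ.
      · have hxx : x ≠ x' := by
          rintro rfl
          exact Set.disjoint_left.1 (hd fun e => hij (Fin.ext e)) hx hx'
        have hyy : y ≠ y' := by
          rintro rfl
          exact Set.disjoint_left.1 (hT.2.1 hij) hy hy'
        have h1 := inner_le_two ((hA i).1 hx) ((hA j).1 hx') hxx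
        have h2 := ((isKissingConfiguration_iff one_pos).1 hT.1).2 y (Set.mem_iUnion.2 ⟨i, hy⟩) y'
          (Set.mem_iUnion.2 ⟨j, hy'⟩) hyy
        linarith

theorem ncard_lifted (hA : ∀ i, IsAdmissible (A i))
    (hd : Pairwise fun i j => Disjoint (A i) (A j)) (hT : IsPartitionedKissing d a b T) :
    (liftedConfiguration A T).ncard = kissingBound A a b := by
  have hAfin : ∀ i, (A i).Finite := fun i => finite_leechMinimalVectors.subset (hA i).1
  have hTfin : ∀ i, (T i).Finite := fun i => by
    refine Set.finite_of_ncard_ne_zero ?_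
    rw [hT.2.2.1 i]
    split_ifs <;> norm_num
  let f : EuclideanSpace ℝ (Fin 24) →
      WithLp 2 (EuclideanSpace ℝ (Fin 24) × EuclideanSpace ℝ (Fin d)) :=
    fun x => WithLp.toLp 2 (x, 0)
  let g : EuclideanSpace ℝ (Fin 24) × EuclideanSpace ℝ (Fin d) →
      WithLp 2 (EuclideanSpace ℝ (Fin 24) × EuclideanSpace ℝ (Fin d)) :=
    fun p => WithLp.toLp 2 (Real.sqrt (2 / 3) • p.1, Real.sqrt (4 / 3) • p.2)
  have hf : Function.Injective f := fun x y h => congrArg (fun p => p.ofLp.1) h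
  have h23 : Real.sqrt (2 / 3) ≠ 0 := by positivity
  have h43 : Real.sqrt (4 / 3) ≠ 0 := by positivity
  have hg : Function.Injective g := fun p q h => Prod.ext
    (smul_right_injective _ h23 (congrArg (fun p => p.ofLp.1) h))
    (smul_right_injective _ h43 (congrArg (fun p => p.ofLp.2) h))
  have e : liftedConfiguration A T = f '' (leechMinimalVectors \ ⋃ i : Fin (a + b), A i.val) ∪
      g '' ⋃ i : Fin (a + b), A i.val ×ˢ T i := by
    ext p
    refine or_congr ⟨?_, ?_⟩ ⟨?_, ?_⟩
    · rintro ⟨x, hx, rfl⟩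
      exact ⟨x, hx, rfl⟩
    · rintro ⟨x, hx, rfl⟩
      exact ⟨x, hx, rfl⟩
    · rintro ⟨i, x, hx, y, hy, rfl⟩
      exact ⟨(x, y), Set.mem_iUnion.2 ⟨i, hx, hy⟩, rfl⟩
    · rintro ⟨⟨x, y⟩, hxy, rfl⟩
      obtain ⟨i, hx, hy⟩ := Set.mem_iUnion.1 hxy
      exact ⟨i, x, hx, y, hy, rfl⟩
  have hU : (⋃ i : Fin (a + b), A i.val) ⊆ leechMinimalVectors :=
    Set.iUnion_subset fun i => (hA i).1
  have hfin2 : (⋃ i : Fin (a + b), A i.val ×ˢ T i).Finite :=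
    Set.finite_iUnion fun i => (hAfin i).prod (hTfin i)
  have hdisj : Disjoint (f '' (leechMinimalVectors \ ⋃ i : Fin (a + b), A i.val))
      (g '' ⋃ i : Fin (a + b), A i.val ×ˢ T i) := by
    refine Set.disjoint_left.2 ?_
    rintro _ ⟨x, hx, rfl⟩ ⟨⟨x', y⟩, hxy, h⟩
    obtain ⟨i, _, hy⟩ := Set.mem_iUnion.1 hxy
    -- A lifted point has nonzero second component, so it is never one of the unmodified points.
    have h0 : Real.sqrt (4 / 3) • y = 0 := congrArg (fun p => p.ofLp.2) h
    have h1 := hT.norm_eq hy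
    rw [(smul_eq_zero.1 h0).resolve_left h43, norm_zero] at h1
    exact zero_ne_one h1
  have hAd : Pairwise (Function.onFun Disjoint fun i : Fin (a + b) => A i.val) :=
    fun i j hij => hd fun e => hij (Fin.ext e)
  have hATd : Pairwise (Function.onFun Disjoint fun i : Fin (a + b) => A i.val ×ˢ T i) :=
    fun i j hij => Set.disjoint_prod.2 (Or.inl (hAd hij))
  rw [e, Set.ncard_union_eq hdisj ((finite_leechMinimalVectors.subset Set.sdiff_subset).image f)
    (hfin2.image g), Set.ncard_image_of_injective _ hf, Set.ncard_image_of_injective _ hg,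
    Set.ncard_iUnion_of_finite (fun i : Fin (a + b) => (hAfin i).prod (hTfin i)) hATd, finsum_eq_sum_of_fintype]
  have e1 := Set.ncard_sdiff_add_ncard_of_subset hU finite_leechMinimalVectors
  rw [Set.ncard_iUnion_of_finite (fun i : Fin (a + b) => hAfin i) hAd, finsum_eq_sum_of_fintype,
    ncard_leechMinimalVectors] at e1
  have e2 : ∑ i : Fin (a + b), (A i.val ×ˢ T i).ncard = ∑ i : Fin (a + b), (A i.val).ncard +
      (∑ i ∈ Finset.range a, (A i).ncard + ∑ i ∈ Finset.range (a + b), (A i).ncard) := by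
    have e3 : ∀ i : Fin (a + b), (A i.val ×ˢ T i).ncard = (A i.val).ncard +
        ((if i.val < a then (A i.val).ncard else 0) + (A i.val).ncard) := by
      intro i
      rw [Set.ncard_prod, hT.2.2.1 i]
      split_ifs <;> ring
    rw [Finset.sum_congr rfl fun i _ => e3 i, Finset.sum_add_distrib, Finset.sum_add_distrib,
      Fin.sum_univ_eq_sum_range (fun i => if i < a then (A i).ncard else 0),
      Fin.sum_univ_eq_sum_range (fun i => (A i).ncard), ← Finset.sum_filter]
    congr 3
    ext i
    simp only [Finset.mem_filter, Finset.mem_range]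
    omega
  rw [e2, kissingBound_eq]
  omega

end Lifted

theorem IsTranslateSequence.realizesBound {S : Set (EuclideanSpace ℝ (Fin 24))}
    {A : ℕ → Set (EuclideanSpace ℝ (Fin 24))} (h : IsTranslateSequence S A) (hS : IsAdmissible S)
    {d a b : ℕ} (hT : ∃ T, IsPartitionedKissing d a b T) : RealizesBound A d a b := by
  obtain ⟨T, hT⟩ := hT
  have hA := h.isAdmissible hS
  exact ⟨T, hT, isKissingConfiguration_lifted hA h.pairwise_disjoint hT,
    ncard_lifted hA h.pairwise_disjoint hT⟩

/-- The configurations give lower bounds for the kissing numbers. -/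
theorem RealizesBound.le_kissingNumber {A : ℕ → Set (EuclideanSpace ℝ (Fin 24))} {d a b n : ℕ}
    (h : RealizesBound A d a b) (hn : 24 + d = n) (hn' : kissingBound A a b ≠ 0) :
    (kissingBound A a b : ℕ∞) ≤ kissingNumber n := by
  subst hn
  obtain ⟨T, hT, hk, hc⟩ := h
  rw [isKissingConfiguration_iff two_pos] at hk
  have hfr : Module.finrank ℝ (WithLp 2 (EuclideanSpace ℝ (Fin 24) × EuclideanSpace ℝ (Fin d))) =
      24 + d := by
    rw [(WithLp.linearEquiv 2 ℝ _).finrank_eq]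
    simp
  -- An orthonormal basis identifies the product with the standard space, and halving brings the
  -- sphere of radius 2 to the unit sphere.
  let φ := ((stdOrthonormalBasis ℝ
    (WithLp 2 (EuclideanSpace ℝ (Fin 24) × EuclideanSpace ℝ (Fin d)))).reindex
      (finCongr hfr)).repr
  let ψ : WithLp 2 (EuclideanSpace ℝ (Fin 24) × EuclideanSpace ℝ (Fin d)) →
    EuclideanSpace ℝ (Fin (24 + d)) := fun p => (1 / 2 : ℝ) • φ p
  have hψ : Function.Injective ψ :=
    (smul_right_injective _ (by norm_num : (1 / 2 : ℝ) ≠ 0)).comp φ.injective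
  have hin : ∀ p q, inner ℝ (ψ p) (ψ q) = (1 / 4 : ℝ) * inner ℝ p q := by
    intro p q
    simp only [ψ, real_inner_smul_left, real_inner_smul_right, φ.inner_map_map]
    ring
  have hkiss : IsKissingConfiguration 1 (ψ '' liftedConfiguration A T) := by
    refine (isKissingConfiguration_iff one_pos).2 ⟨?_, ?_⟩
    · rintro _ ⟨p, hp, rfl⟩
      refine norm_eq_of_inner_self one_pos.le ?_
      rw [hin, real_inner_self_eq_norm_sq, hk.1 p hp]
      norm_num
    · rintro _ ⟨p, hp, rfl⟩ _ ⟨q, hq, rfl⟩ hne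
      have := hk.2 p hp q hq fun e => hne (by rw [e])
      rw [hin]
      linarith
  -- An infinite set has `ncard` 0, so a nonzero count gives finiteness and agreement with `encard`.
  have hfin : (liftedConfiguration A T).Finite :=
    Set.finite_of_ncard_ne_zero (hc.symm ▸ hn')
  refine le_trans ?_ (le_iSup (fun T : {T : Set (EuclideanSpace ℝ (Fin (24 + d))) //
    IsKissingConfiguration 1 T} => T.1.encard) ⟨_, hkiss⟩)
  rw [hψ.injOn.encard_image, ← hfin.cast_ncard_eq, hc]

/-! ### Large antipodal admissible sets -/

theorem neg_mem_leechMinimalVectors {v : EuclideanSpace ℝ (Fin 24)}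
    (hv : v ∈ leechMinimalVectors) : -v ∈ leechMinimalVectors :=
  ⟨leechLattice.neg_mem hv.1, by rw [norm_neg]; exact hv.2⟩

/-- Minimal vectors with pairwise inner products in `[-1, 1]` and their negatives. -/
theorem exists_antipodal_of_pairwise {L : List ℕ} {u : ℕ → EuclideanSpace ℝ (Fin 24)}
    (hmem : ∀ n ∈ L, u n ∈ leechMinimalVectors)
    (hpair : L.Pairwise fun m n => |(inner ℝ (u m) (u n) : ℝ)| ≤ 1) :
    ∃ S, IsAdmissible S ∧ IsAntipodal S ∧ S.ncard = 2 * L.length := by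
  have hself : ∀ n ∈ L, inner ℝ (u n) (u n) = (4 : ℝ) := fun n hn => by
    rw [real_inner_self_eq_norm_sq, norm_of_mem_minimal (hmem n hn)]
    norm_num
  have hne : ∀ m ∈ L, ∀ n ∈ L, m ≠ n → |(inner ℝ (u m) (u n) : ℝ)| ≤ 1 := by
    intro m hm n hn hmn
    have : Std.Symm fun m n => |(inner ℝ (u m) (u n) : ℝ)| ≤ 1 :=
      ⟨fun m n h => by rwa [real_inner_comm]⟩
    exact hpair.forall hm hn hmn
  -- A repeated vector would have inner product 4 with itself; the same bound later keeps vectors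
  -- and negatives apart.
  have hnd : L.Nodup := by
    refine hpair.imp_of_mem fun {m n} hm _ h e => ?_
    rw [← e, hself m hm] at h
    norm_num at h
  set B := u '' {n | n ∈ L} with hB
  have hBmem : ∀ v ∈ B, v ∈ leechMinimalVectors := by
    rintro _ ⟨n, hn, rfl⟩
    exact hmem n hn
  have hBne : ∀ v ∈ B, ∀ w ∈ B, v ≠ w → |(inner ℝ v w : ℝ)| ≤ 1 := by
    rintro _ ⟨m, hm, rfl⟩ _ ⟨n, hn, rfl⟩ h
    exact hne m hm n hn fun e => h (by rw [e])
  have hBself : ∀ v ∈ B, inner ℝ v v = (4 : ℝ) := by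
    rintro _ ⟨n, hn, rfl⟩
    exact hself n hn
  have hfin : {n | n ∈ L} = ((L.toFinset : Finset ℕ) : Set ℕ) := by
    ext n
    simp
  have hBcard : B.ncard = L.length := by
    rw [hB, Set.InjOn.ncard_image, hfin, Set.ncard_coe_finset, List.toFinset_card_of_nodup hnd]
    intro m hm n hn h
    by_contra hmn
    have h1 := hne m hm n hn hmn
    rw [← h, hself m hm] at h1
    norm_num at h1
  have hBfin : B.Finite := finite_leechMinimalVectors.subset hBmem
  refine ⟨B ∪ Neg.neg '' B, ⟨?_, ?_⟩, ?_, ?_⟩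
  · rintro v (hv | ⟨w, hw, rfl⟩)
    · exact hBmem v hv
    · exact neg_mem_leechMinimalVectors (hBmem w hw)
  · rintro x (hx | ⟨x, hx, rfl⟩) y (hy | ⟨y, hy, rfl⟩) hxy
    · exact (abs_le.1 (hBne x hx y hy hxy)).2
    · rw [inner_neg_right]
      by_cases h : x = y
      · rw [h, hBself y hy]
        norm_num
      · linarith [(abs_le.1 (hBne x hx y hy h)).1]
    · rw [inner_neg_left]
      by_cases h : x = y
      · rw [h, hBself y hy]
        norm_num
      · linarith [(abs_le.1 (hBne x hx y hy h)).1]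
    · rw [inner_neg_neg]
      exact (abs_le.1 (hBne x hx y hy fun e => hxy (by rw [e]))).2
  · rintro v (hv | ⟨w, hw, rfl⟩)
    · exact Or.inr ⟨v, hv, rfl⟩
    · rw [neg_neg]
      exact Or.inl hw
  · rw [Set.ncard_union_eq _ hBfin (hBfin.image _), Set.ncard_image_of_injective _ neg_injective,
      hBcard, two_mul]
    refine Set.disjoint_left.2 ?_
    rintro _ hv ⟨w, hw, rfl⟩
    have h0 := hBself w hw
    by_cases h : -w = w
    · have h1 : inner ℝ (-w) w = (4 : ℝ) := by rw [h, h0]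
      rw [inner_neg_left, h0] at h1
      norm_num at h1
    · have h1 := hBne (-w) hv w hw h
      rw [inner_neg_left, h0] at h1
      norm_num at h1

/-! ### Integral vectors encoded by hexadecimal numbers -/

/-- The hexadecimal digit number `i`. -/
def hexDigit (n i : ℕ) : ℕ := n / 16 ^ i % 16

/-- The vector whose entries, increased by four, are the hexadecimal digits of `n`. -/
def hexVec (n : ℕ) : Fin 24 → ℤ := fun i => (hexDigit n i : ℤ) - 4

/-- The bit mask formed by the second lowest bits of the hexadecimal digits. -/
def hexMask (n : ℕ) : ℕ := ∑ i : Fin 24, hexDigit n i / 2 % 2 * 2 ^ i.val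

/-- The sum of the products of the lowest `k` hexadecimal digits. -/
def hexDot : ℕ → ℕ → ℕ → ℕ
  | 0, _, _ => 0
  | k + 1, m, n => (m % 16) * (n % 16) + hexDot k (m / 16) (n / 16)

/-- The sum of the lowest `k` hexadecimal digits. -/
def hexSum : ℕ → ℕ → ℕ
  | 0, _ => 0
  | k + 1, n => n % 16 + hexSum k (n / 16)

theorem hexDigit_zero (n : ℕ) : hexDigit n 0 = n % 16 := by simp [hexDigit]

theorem hexDigit_succ (n i : ℕ) : hexDigit n (i + 1) = hexDigit (n / 16) i := by
  rw [hexDigit, hexDigit, pow_succ', Nat.div_div_eq_div_mul]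

theorem hexDot_eq (k m n : ℕ) :
    hexDot k m n = ∑ i ∈ Finset.range k, hexDigit m i * hexDigit n i := by
  induction k generalizing m n with
  | zero => simp [hexDot]
  | succ k ih =>
    rw [hexDot, ih, Finset.sum_range_succ', hexDigit_zero, hexDigit_zero, add_comm]
    simp only [hexDigit_succ]

theorem hexSum_eq (k n : ℕ) : hexSum k n = ∑ i ∈ Finset.range k, hexDigit n i := by
  induction k generalizing n with
  | zero => simp [hexSum]
  | succ k ih =>
    rw [hexSum, ih, Finset.sum_range_succ', hexDigit_zero, add_comm]
    simp only [hexDigit_succ]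

theorem sum_hexVec_mul (m n : ℕ) : ∑ i, hexVec m i * hexVec n i =
    (hexDot 24 m n : ℤ) - 4 * hexSum 24 m - 4 * hexSum 24 n + 384 := by
  rw [hexDot_eq, hexSum_eq, hexSum_eq, Finset.sum_range, Finset.sum_range, Finset.sum_range]
  have h : ∀ i : Fin 24, hexVec m i * hexVec n i =
      ((hexDigit m i * hexDigit n i : ℕ) : ℤ) - 4 * (hexDigit m i : ℕ) - 4 * (hexDigit n i : ℕ)
        + 16 := by
    intro i
    simp only [hexVec]
    push_cast
    ring
  rw [Finset.sum_congr rfl fun i _ => h i, Finset.sum_add_distrib, Finset.sum_sub_distrib,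
    Finset.sum_sub_distrib, ← Finset.mul_sum, ← Finset.mul_sum]
  push_cast
  simp

/-- A computable criterion for `hexVec n` to be a minimal vector. -/
def IsMinimalCode (n : ℕ) : Prop :=
  (∀ i : Fin 24, hexDigit n i % 2 = n % 2 ∧
    ((hexMask n).testBit i = true ↔ hexDigit n i / 2 % 2 = 1)) ∧
  golayWord (golayDecode (hexMask n)) = hexMask n ∧ hexSum 24 n % 8 = 4 * (n % 2) ∧
  hexDot 24 n n + 352 = 8 * hexSum 24 n

instance (n : ℕ) : Decidable (IsMinimalCode n) := by
  unfold IsMinimalCode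
  infer_instance

/-- An entry `digit - 4` equals `m + 2 * (digit / 2 - 2)` with `m` the common parity of the digits,
so the second lowest bits form the Golay word. The offset contributes `96 ≡ 0` to the sum modulo 8.
Squared length 32 reads `hexDot - 8 * hexSum + 384 = 32`. -/
theorem IsMinimalCode.mem {n : ℕ} (h : IsMinimalCode n) :
    toE (hexVec n) ∈ leechMinimalVectors := by
  obtain ⟨h1, h2, h3, h4⟩ := h
  refine mem_leechMinimalVectors.2 ⟨_, ⟨⟨(n % 2 : ℕ), fun i => (hexDigit n i / 2 : ℕ) - 2, ?_, ?_, ?_⟩,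
    ?_⟩, rfl⟩
  · intro i
    have := (h1 i).1
    simp only [hexVec]
    omega
  · rw [cast_mem_golayCode]
    convert mem_golaySets_of_golayDecode h2 using 1
    ext i
    rw [mem_oddSet, mem_bits, (h1 i).2, Int.odd_iff]
    omega
  · have e : ∑ i, hexVec n i = (hexSum 24 n : ℤ) - 96 := by
      rw [hexSum_eq, Finset.sum_range]
      simp only [hexVec, Finset.sum_sub_distrib]
      push_cast
      simp
    rw [e, Int.ModEq]
    omega
  · have := sum_hexVec_mul n n
    simp only [sq]
    omega

/-- The criterion for an inner product in `[-1, 1]`. -/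
def IsNearlyOrthogonal (m n : ℕ) : Prop :=
  -- The constants are `384 ∓ 8`: 384 comes from the offsets, and 8 is the inner product 1 in
  -- integral scale.
  hexDot 24 m n + 376 ≤ 4 * (hexSum 24 m + hexSum 24 n) ∧
    4 * (hexSum 24 m + hexSum 24 n) ≤ hexDot 24 m n + 392

instance (m n : ℕ) : Decidable (IsNearlyOrthogonal m n) := by
  unfold IsNearlyOrthogonal
  infer_instance

theorem IsNearlyOrthogonal.abs_inner_le {m n : ℕ} (h : IsNearlyOrthogonal m n) :
    |(inner ℝ (toE (hexVec m)) (toE (hexVec n)) : ℝ)| ≤ 1 := by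
  obtain ⟨h1, h2⟩ := h
  have e := sum_hexVec_mul m n
  have h3 : ∑ i, hexVec m i * hexVec n i ≤ 8 := by omega
  have h4 : -8 ≤ ∑ i, hexVec m i * hexVec n i := by omega
  have h3' : ((∑ i, hexVec m i * hexVec n i : ℤ) : ℝ) ≤ 8 := by exact_mod_cast h3
  have h4' : (-8 : ℝ) ≤ ((∑ i, hexVec m i * hexVec n i : ℤ) : ℝ) := by exact_mod_cast h4
  rw [inner_toE, abs_le]
  constructor <;> linarith

/-- Representatives of 240 pairs of opposite minimal vectors with pairwise inner products in
`[-1, 1]`. -/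
def minimalCodes : List ℕ :=
  [0x353535555535753553333335, 0x353335335555135333553535, 0x553373335533335333353355,
    0x553555575353555353553535, 0x553333337555533555533535, 0x353535355373333553535555,
    0x357355333353353335335335, 0x335335533555555333333155, 0x353533533533533755535555,
    0x353553353355333315535535, 0x331333333555535535355535, 0x353335533553533531555335,
    0x353735535535335353335555, 0x153353555355535333353335, 0x553535535355355553535315,
    0x353555331535333533353555, 0x553335513333535535353355, 0x353531335333535355353555,
    0x353553355555355553331555, 0x353555535333353133555335, 0x353355353331333535555355,
    0x335353555555535375553555, 0x553555357333533355335355, 0x553355333333555555337535,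
    0x553555553335555333515355, 0x535535353573353335553535, 0x553535353335333555313535,
    0x553533155353555535555335, 0x353335533357535553533555, 0x553555335555535753355355,
    0x555553533535553351355355, 0x333555553755535333533535, 0x555351333535353555553555,
    0x333553333333535335335135, 0x555335355355551353555335, 0x355333553553133535333555,
    0x355333555535375353553335, 0x555133355553335553555355, 0x533535333353535575553535,
    0x355535353335153355555555, 0x573533553335535533355535, 0x555335353515533555355355,
    0x555353535575353533353335, 0x555333551333353553535335, 0x555333355535333153333555,
    0x355535733535353535355335, 0x533335531355353335335555, 0x355555535353335513355555,
    0x555335355133335333535535, 0x333353535335313535553555, 0x555353335333733533555555,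
    0x355555355315555333353555, 0x333355355353353533355515, 0x533733355333353333533555,
    0x335355335553535535553337, 0x353333335335353533335755, 0x535533553537333533535555,
    0x357353555335333553355535, 0x535335553555555553355537, 0x135553335533333333333535,
    0x513333355355353555555555, 0x535155535533353535355555, 0x313535333355333533533335,
    0x533333373533533333555535, 0x355555533553357355555535, 0x533333533335553333753355,
    0x555553533335155333333535, 0x355535553333531333335555, 0x555553337355355353555555,
    0x355333375333553555533555, 0x537335533355333555553355, 0x333555535333535353531355,
    0x533753555555355535355535, 0x515535555335535335553535, 0x355535557355353335333535,
    0x355353353353353331553555, 0x333355535337355355355535, 0x333355353375555355535335,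
    0x355353533535535335335557, 0x315353553555333335355335, 0x333553355335535553535537,
    0x533535555355335535333375, 0x555355155355333535353555, 0x355333535353353535755535,
    0x555355755535535533553355, 0x355333335533555533155335, 0x555355353553733355333535,
    0x533533535335353555351335, 0x333153553353533553335555, 0x533553553553333553553357,
    0x535357353533335353553555, 0x153535553333355533533535, 0x553555335355533331333535,
    0x553533353555555355535755, 0x553355553553555315355335, 0x313533355553555353353335,
    0x535533333333333535355537, 0x353533355535333355355315, 0x353537335335533535555535,
    0x553353333353335733533535, 0x335355333555333555535735, 0x335375555533555353335335,
    0x353533533555351353533535, 0x553353535533553555555135, 0x353553515535555533553535,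
    0x353335355533515533333555, 0x353553553513353355333355, 0x353335353555353755553335,
    0x335335355535533335515335, 0x553553333357555335353355, 0x535555533533333315533355,
    0x535535355555555553733355, 0x535555735553553555533535, 0x553333533735335553333335,
    0x553353355353153355533335, 0x553337535535353355533355, 0x335553333335335353573335,
    0x353313553353535335535355, 0x335573333555355533535355, 0x335533555353513555333335,
    0x444222644446444444264464, 0x244444444464642624442644, 0x644444466424464642446444,
    0x466444444244646464444246, 0x244444466442246244444464, 0x444426442444226644446444,
    0x244444646422644426444444, 0x444444242462446444244466, 0x644444642644424446464644,
    0x244444244444446644664664, 0x444444644642424444246264, 0x644444644224444464444666,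
    0x466642244424444444426444, 0x644444664244242424464444, 0x244444624244642464464444,
    0x444444224244444446624466, 0x644444224426426444444644, 0x444446424242242444442644,
    0x444442464244464244246446, 0x444442462444446446442426, 0x444442444442442264646464,
    0x444442442424644442422644, 0x444442442246424466446444, 0x244442442244444644442264,
    0x444442626644244246444444, 0x244424646664446644444444, 0x444644644242244446426444,
    0x444464646466424444426444, 0x244464244446642444246444, 0x444464264444464464464264,
    0x444424444264464264442464, 0x644424444444624462426444, 0x444644442426466664444444,
    0x444464446624444444624664, 0x244424446444644242644644, 0x444424424444664246444426,
    0x244424424442244464444246, 0x444424424646444464666444, 0x444464462642464644444644,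
    0x244424462644444462444464, 0x444466642244424444444426, 0x444462444222466444644444,
    0x444462446462444646444464, 0x444244246424444246664444, 0x244646444466464442464444,
    0x444664424424444446466464, 0x644646444444642444462464, 0x444244442244646244464644,
    0x444644444464624244466446, 0x444644444644662424646444, 0x444244444246444624446246,
    0x222442444446444244424464, 0x244244444664464244244644, 0x444244444666444426644464,
    0x644644444622646444444446, 0x444644422244444442646644, 0x444266446244444664644444,
    0x444264644244444246444264, 0x444664444464242244244464, 0x244264462426444444644444,
    0x442464224464442444664444, 0x446424644464244242446444, 0x442444426442426444646444,
    0x442424464426464426444444, 0x646464464444444446646446, 0x446424446444424446446664,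
    0x246422244466444444444446, 0x446444464264266644444444, 0x446444424446442224464644,
    0x446444466464644442244464, 0x446444446446664646464444, 0x446444644442444244262446,
    0x642444244644462444244446, 0x642442444464444422446464, 0x646442444264442444424644,
    0x442446464444444444266664, 0x446446424424444642424446, 0x646442624444446644446444,
    0x646622464444444464464444, 0x446244444446464464426464, 0x246226464444444424464444,
    0x446242446444446424442644, 0x264444446644442444464466, 0x646646444246444444246444,
    0x246642644444464444444664, 0x246646244444424444444264, 0x446644464444444422444226,
    0x424642244644424446644444, 0x242644446444464466644444, 0x442244446444666444444466,
    0x442244444424242462464444, 0x424244224444444242446446, 0x464244444424442424442426,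
    0x224644464424442644464444, 0x624264444446444444422446, 0x464664444244462644444446,
    0x464444242644444244644246, 0x464444224642444426444644, 0x224444444444464646224446,
    0x464444446424246646444446, 0x464442646442444442424446, 0x224446644444444444646466,
    0x464446464446426246444444, 0x624446444242464444444246, 0x424424424644444444442666,
    0x424442444624444464246644, 0x264446442444664446444464, 0x424424444442466424446644,
    0x264464444244444264424644, 0x424424444242424442464464, 0x464462642464644444644444,
    0x426644442444444264424446, 0x466644444444424444642646, 0x466424422444444464244644,
    0x666424444444464424444466, 0x422464444442444246444646, 0x462444664644244444646444,
    0x462444644444444224442664, 0x422444644424444422244446, 0x462444644464444466244446]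

theorem isMinimalCode_minimalCodes : ∀ n ∈ minimalCodes, IsMinimalCode n := by
  decide +kernel

theorem pairwise_minimalCodes : minimalCodes.Pairwise IsNearlyOrthogonal := by
  decide +kernel

theorem length_minimalCodes : minimalCodes.length = 240 := by
  decide +kernel

attribute [irreducible] minimalCodes

/-- Pairwise conditions pass to initial segments, so one list serves for both sizes. -/
theorem exists_admissible_of_le {k : ℕ} (hk : k ≤ 240) :
    ∃ S, IsAdmissible S ∧ IsAntipodal S ∧ S.ncard = 2 * k := by
  have h := exists_antipodal_of_pairwise (L := minimalCodes.take k) (u := fun n => toE (hexVec n))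
    (fun n hn => (isMinimalCode_minimalCodes n (List.mem_of_mem_take hn)).mem)
    ((pairwise_minimalCodes.sublist (List.take_sublist _ _)).imp fun h => h.abs_inner_le)
  rwa [List.length_take, length_minimalCodes, min_eq_left hk] at h

theorem exists_admissible_480 : ∃ S, IsAdmissible S ∧ IsAntipodal S ∧ S.ncard = 480 :=
  exists_admissible_of_le (k := 240) le_rfl

theorem exists_admissible_288 : ∃ S, IsAdmissible S ∧ IsAntipodal S ∧ S.ncard = 288 :=
  exists_admissible_of_le (k := 144) (by norm_num)

/-! ### The main theorem -/

theorem mainTheorem4 :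
    -- the new lower bounds
    (197040 ≤ kissingNumber 25 ∧ 198480 ≤ kissingNumber 26 ∧ 199912 ≤ kissingNumber 27 ∧
      204188 ≤ kissingNumber 28 ∧ 207930 ≤ kissingNumber 29 ∧ 219008 ≤ kissingNumber 30 ∧
      230872 ≤ kissingNumber 31) ∧
    -- the two starting sets
    (∃ S, IsAdmissible S ∧ IsAntipodal S ∧ S.ncard = 480) ∧
    (∃ S, IsAdmissible S ∧ IsAntipodal S ∧ S.ncard = 288) ∧
    -- what the construction gives from an arbitrary starting set, and from sets of these two sizes
    ∀ S, IsAdmissible S → ∃ A, IsTranslateSequence S A ∧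
      (RealizesBound A 1 0 1 ∧ RealizesBound A 2 2 0 ∧ RealizesBound A 3 2 3 ∧
        RealizesBound A 4 8 0 ∧ RealizesBound A 5 8 8 ∧ RealizesBound A 6 24 0 ∧
        RealizesBound A 7 24 27) ∧
      (IsAntipodal S → S.ncard = 288 →
        (196656 < 196848 ∧ 196848 ≤ kissingBound A 0 1) ∧
        (196848 < 197712 ∧ 197712 ≤ kissingBound A 2 0) ∧
        (197142 < 198576 ∧ 198576 ≤ kissingBound A 2 3) ∧
        (197736 < 201156 ∧ 201156 ≤ kissingBound A 8 0) ∧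
        (198506 < 203430 ∧ 203430 ≤ kissingBound A 8 8) ∧
        (200046 < 210200 ∧ 210200 ≤ kissingBound A 24 0) ∧
        (202692 < 217588 ∧ 217588 ≤ kissingBound A 24 27)) ∧
      (IsAntipodal S → S.ncard = 480 →
        197040 ≤ kissingBound A 0 1 ∧ 198480 ≤ kissingBound A 2 0 ∧
        199912 ≤ kissingBound A 2 3 ∧ 204188 ≤ kissingBound A 8 0 ∧
        207930 ≤ kissingBound A 8 8 ∧ 219008 ≤ kissingBound A 24 0 ∧
        230872 ≤ kissingBound A 24 27) := by
  have key : ∀ S, IsAdmissible S → ∃ A, IsTranslateSequence S A ∧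
      (RealizesBound A 1 0 1 ∧ RealizesBound A 2 2 0 ∧ RealizesBound A 3 2 3 ∧
        RealizesBound A 4 8 0 ∧ RealizesBound A 5 8 8 ∧ RealizesBound A 6 24 0 ∧
        RealizesBound A 7 24 27) := by
    intro S hS
    obtain ⟨A, hA⟩ := exists_isTranslateSequence hS.1
    exact ⟨A, hA, hA.realizesBound hS exists_isPartitionedKissing_one,
      hA.realizesBound hS exists_isPartitionedKissing_two,
      hA.realizesBound hS exists_isPartitionedKissing_three,
      hA.realizesBound hS exists_isPartitionedKissing_four,
      hA.realizesBound hS exists_isPartitionedKissing_five,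
      hA.realizesBound hS exists_isPartitionedKissing_six,
      hA.realizesBound hS exists_isPartitionedKissing_seven⟩
  refine ⟨?_, exists_admissible_480, exists_admissible_288, fun S hS => ?_⟩
  · obtain ⟨S, hS, ha, hc⟩ := exists_admissible_480
    obtain ⟨A, hA, h1, h2, h3, h4, h5, h6, h7⟩ := key S hS
    obtain ⟨b1, b2, b3, b4, b5, b6, b7⟩ := hA.le_kissingBound_of_480 hS ha hc
    have bound : ∀ {d a b n m : ℕ}, RealizesBound A d a b → 24 + d = n → m ≤ kissingBound A a b →
        (m : ℕ∞) ≤ kissingNumber n := fun h hn hm =>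
      (Nat.cast_le.2 hm).trans (h.le_kissingNumber hn (by unfold kissingBound; omega))
    exact ⟨bound h1 rfl b1, bound h2 rfl b2, bound h3 rfl b3, bound h4 rfl b4, bound h5 rfl b5,
      bound h6 rfl b6, bound h7 rfl b7⟩
  · obtain ⟨A, hA, hR⟩ := key S hS
    refine ⟨A, hA, hR, fun ha hc => ?_, fun ha hc => hA.le_kissingBound_of_480 hS ha hc⟩
    obtain ⟨b1, b2, b3, b4, b5, b6, b7⟩ := hA.le_kissingBound_of_288 hS ha hc
    exact ⟨⟨by norm_num, b1⟩, ⟨by norm_num, b2⟩, ⟨by norm_num, b3⟩, ⟨by norm_num, b4⟩,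
      ⟨by norm_num, b5⟩, ⟨by norm_num, b6⟩, ⟨by norm_num, b7⟩⟩
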